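/- Let $0<q<1$, let $n\ge 2$, $1\le l\le n/2$ and $1\le r\le l$ be integers, let $\sigma\in\mathbb R$, and write $k'=n+1-k$, $I'=\{i' : i\in I\}$. Let $A_q(U)$ be the complex algebra with generators $t_{ij}$ ($1\le i,j\le n$) and $\det_q^{-1}$, and relations $t_{ki}t_{kj}=q\,t_{kj}t_{ki}$, $t_{ik}t_{jk}=q\,t_{jk}t_{ik}$ ($i<j$), $t_{im}t_{kj}=t_{kj}t_{im}$, $t_{ij}t_{km}-t_{km}t_{ij}=(q-q^{-1})t_{im}t_{kj}$ ($i<k$, $j<m$), $\det_q\det_q^{-1}=\det_q^{-1}\det_q=1$, where $\det_q=\sum_{s\in\mathfrak S_n}(-q)^{\ell(s)}t_{1s(1)}\cdots t_{ns(n)}$. Put $t_{ij}^*=(-q)^{j-i}\,\xi^{i^c}_{j^c}\,\det_q^{-1}$, where $i^c=\{1,\dots,n\}\setminus\{i\}$ and $\xi^I_J=\sum_{s}(-q)^{\ell(s)}t_{i_1j_{s(1)}}\cdots t_{i_mj_{s(m)}}$ for $I=\{i_1<\dots<i_m\}$, $J=\{j_1<\dots<j_m\}$. Let $V=\mathbb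 C^n$ with basis $(v_i)$ and dual basis $(v_i^*)$ of $V^*$, with the right $A_q(U)$-coactions $v_j\mapsto\sum_i v_i\otimes t_{ij}$ and $v_j^*\mapsto\sum_i v_i^*\otimes t_{ij}^*$; tensor products carry the coaction $v\otimes w\mapsto\sum v_{(1)}\otimes w_{(1)}\otimes v_{(2)}w_{(2)}$. Let $\Lambda_q(V)$ (resp. $\Lambda_q(V^*)$) be the algebra generated by the $v_i$ (resp. $v_i^*$) with relations $v_i\wedge v_i=0$, $v_i\wedge v_j=-q^{-1}v_j\wedge v_i$ (resp. $v_i^*\wedge v_i^*=0$, $v_j^*\wedge v_i^*=-q^{-1}v_i^*\wedge v_j^*$) for $i<j$; the coaction of $V$ (resp. $V^*$) extends, uniquely, to an algebra homomorphism $\Lambda_q(V)\to\Lambda_q(V)\otimes A_q(U)$ (resp. $\Lambda_q(V^*)\to\Lambda_q(V^*)\otimes A_q(U)$), and this defines the coactions on the components $\Lambda_q^r(V)$, $\Lambda_q^r(V^*)$ of degree $r$. For $I=\{i_1<\dots<i_r\}$ write $v_I=v_{i_1}\wedge\dots\wedge v_{i_r}$ and $v_I^*=v_{i_r}^*\wedge\dots\wedge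 v_{i_1}^*$. Let $\mathrm{pr}_r\colon V^{\otimes r}\to\Lambda_q^r(V)$ and $\mathrm{pr}_r^*\colon (V^*)^{\otimes r}\to\Lambda_q^r(V^*)$ be the canonical projections. Let $\beta\colon V^*\otimes V\to V\otimes V^*$ be the linear map $$\beta(v_i^*\otimes v_j)=q^{-\delta_{ij}}v_j\otimes v_i^*+(q^{-1}-q)\delta_{ij}\sum_{k<j}v_k\otimes v_k^*,$$ and let $\Psi_r\colon (V_1\otimes V_1^*)\otimes\cdots\otimes(V_r\otimes V_r^*)\to(V_1\otimes\cdots\otimes V_r)\otimes(V_1^*\otimes\cdots\otimes V_r^*)$, with $V_i=V$, be $\Psi_r=\beta_{1r}\circ\beta_{2r}\circ\cdots\circ\beta_{r-1,r}\circ\cdots\circ\beta_{13}\circ\beta_{23}\circ\beta_{12}$, where $\beta_{ij}$ is $\beta$ on the factors $V_i^*\otimes V_j$ and the identity on the others. Put $\widehat\Psi_r=(\mathrm{pr}_r\otimes\mathrm{pr}_r^*)\circ\Psi_r$. For a vector $v$ in a right $A_q(U)$-comodule, its component $v_\mu$ of weight $\mu\in\mathbb Z^n$ is the coefficient of $z^\mu$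 when the coaction on $v$ is followed by the algebra homomorphism $A_q(U)\to\mathbb C[z_1^{\pm1},\dots,z_n^{\pm1}]$, $t_{ij}\mapsto\delta_{ij}z_i$. For $v\in\Lambda_q^r(V)\otimes\Lambda_q^r(V^*)$ the principal term is $$[v]=\sum_{\nu}v_{\nu^\flat},\qquad \nu^\flat=(\nu_1,\dots,\nu_l,0,\dots,0,-\nu_l,\dots,-\nu_1),$$ the sum being over the orbit of $(1^r)=(1,\dots,1,0,\dots,0)\in\mathbb Z^l$ under permutations and sign changes. Let $$u_r=\sum_I v_I\otimes v_{I'}^*,\qquad \tilde u_r=\sum_I q^{\sum_{i\in I'}2(n-i)}\,v_I\otimes v_{I'}^*,$$ the sums being over $I\subset\{1,\dots,l\}\cup\{l',\dots,n\}$ with $|I|=r$ and $I\cap I'=\emptyset$. Let $w^\sigma=\sum_{i,j}J^\sigma_{ij}v_i\otimes v_j^*$ and $\tilde w^\sigma=\sum_{i,j}\tilde J^\sigma_{ij}v_i\otimes v_j^*$, where, with matrix units $e_{ij}$, $$J^\sigma=\sum_{k\le l}(1-q^{2\sigma})e_{kk}+\sum_{l<k<l'}e_{kk}-\sum_{k\le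 l}q^\sigma e_{kk'}-\sum_{k\le l}q^\sigma e_{k'k},$$ $$\tilde J^\sigma=\sum_{k\le l}(1-q^{2(n-2l)}q^{2\sigma})e_{kk}+\sum_{l<k<l'}e_{kk}-q^{\sigma-1}\sum_{k\le l}q^{2(k-l)}e_{kk'}-q^{\sigma-1}\sum_{k\le l}q^{2(k'-l)}e_{k'k}.$$ Then $\widehat\Psi_r\colon(V\otimes V^*)^{\otimes r}\to\Lambda_q^r(V)\otimes\Lambda_q^r(V^*)$ is surjective and intertwines the right $A_q(U)$-coactions, and $$[\widehat\Psi_r((w^\sigma)^{\otimes r})]=c_r(\sigma)\,u_r,\qquad [\widehat\Psi_r((\tilde w^\sigma)^{\otimes r})]=\tilde c_r(\sigma)\,\tilde u_r,$$ with the nonzero constants $$c_r(\sigma)=\Bigl(\frac{q^\sigma}{q^2-1}\Bigr)^r(q^2;q^2)_r,\qquad \tilde c_r(\sigma)=\Bigl(\frac{q^{\sigma-1}q^{2(1-l)}}{q^2-1}\Bigr)^r(q^2;q^2)_r,\qquad (q^2;q^2)_r=\prod_{j=1}^r(1-q^{2j}).$$ -/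

import Mathlib

open scoped TensorProduct

noncomputable section

namespace QGrass

/-! ### The quantized coordinate ring -/

/-- Generators of the quantized coordinate ring: the `t i j` and the inverse `d` of the quantum
determinant. Indices `1, …, n` are represented by `Fin n`, i.e. by `0, …, n - 1`. -/
inductive Gen (n : ℕ) : Type
  | t (i j : Fin n) : Gen n
  | d : Gen n

/-- The length `l(s)` of a permutation (its number of inversions). -/
def permLength {r : ℕ} (s : Equiv.Perm (Fin r)) : ℕ :=
  (Finset.univ.filter fun p : Fin r × Fin r => p.1 < p.2 ∧ s p.2 < s p.1).card

/-- The quantum minor `∑ₛ (-q)^{l(s)} x_{a₁ b_{s(1)}} ⋯ x_{aᵣ b_{s(r)}}` with rows `a₁ < ⋯ < aᵣ` and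
columns `b₁ < ⋯ < bᵣ` of a matrix `x` over a (noncommutative) algebra. -/
def qMinor {n r : ℕ} {A : Type*} [Ring A] [Algebra ℂ A] (q : ℝ) (x : Fin n → Fin n → A)
    (a b : Fin r ↪o Fin n) : A :=
  ∑ s : Equiv.Perm (Fin r),
    (-(q : ℂ)) ^ permLength s • (List.ofFn fun k => x (a k) (b (s k))).prod

/-- The quantum determinant. -/
def qDet {n : ℕ} {A : Type*} [Ring A] [Algebra ℂ A] (q : ℝ) (x : Fin n → Fin n → A) : A :=
  qMinor q x (OrderIso.refl (Fin n)).toOrderEmbedding (OrderIso.refl (Fin n)).toOrderEmbedding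

/-- The defining relations of `A_q(GL(n, ℂ))`. -/
inductive AqRel (n : ℕ) (q : ℝ) : FreeAlgebra ℂ (Gen n) → FreeAlgebra ℂ (Gen n) → Prop
  | row (k i j : Fin n) (h : i < j) :
      AqRel n q (FreeAlgebra.ι ℂ (Gen.t k i) * FreeAlgebra.ι ℂ (Gen.t k j))
        ((q : ℂ) • (FreeAlgebra.ι ℂ (Gen.t k j) * FreeAlgebra.ι ℂ (Gen.t k i)))
  | col (k i j : Fin n) (h : i < j) :
      AqRel n q (FreeAlgebra.ι ℂ (Gen.t i k) * FreeAlgebra.ι ℂ (Gen.t j k))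
        ((q : ℂ) • (FreeAlgebra.ι ℂ (Gen.t j k) * FreeAlgebra.ι ℂ (Gen.t i k)))
  | comm (i k j l : Fin n) (hik : i < k) (hjl : j < l) :
      AqRel n q (FreeAlgebra.ι ℂ (Gen.t i l) * FreeAlgebra.ι ℂ (Gen.t k j))
        (FreeAlgebra.ι ℂ (Gen.t k j) * FreeAlgebra.ι ℂ (Gen.t i l))
  | cross (i k j l : Fin n) (hik : i < k) (hjl : j < l) :
      AqRel n q
        (FreeAlgebra.ι ℂ (Gen.t i j) * FreeAlgebra.ι ℂ (Gen.t k l)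
          - FreeAlgebra.ι ℂ (Gen.t k l) * FreeAlgebra.ι ℂ (Gen.t i j))
        (((q : ℂ) - (q : ℂ)⁻¹) •
          (FreeAlgebra.ι ℂ (Gen.t i l) * FreeAlgebra.ι ℂ (Gen.t k j)))
  | det_mul_d :
      AqRel n q (qDet q (fun i j => FreeAlgebra.ι ℂ (Gen.t i j)) * FreeAlgebra.ι ℂ Gen.d) 1
  | d_mul_det :
      AqRel n q (FreeAlgebra.ι ℂ Gen.d * qDet q (fun i j => FreeAlgebra.ι ℂ (Gen.t i j))) 1

/-- The quantized coordinate ring `A_q(U) = A_q(G)`, `G = GL(n, ℂ)`. -/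
abbrev Aq (n : ℕ) (q : ℝ) : Type := RingQuot (AqRel n q)

/-- The generator `t_{ij}`. -/
def t {n : ℕ} (q : ℝ) (i j : Fin n) : Aq n q :=
  RingQuot.mkAlgHom ℂ (AqRel n q) (FreeAlgebra.ι ℂ (Gen.t i j))

/-- The inverse `det_q⁻¹` of the quantum determinant. -/
def detInv (n : ℕ) (q : ℝ) : Aq n q :=
  RingQuot.mkAlgHom ℂ (AqRel n q) (FreeAlgebra.ι ℂ Gen.d)

/-- The increasing enumeration of `{1, …, n} \ {i}`. -/
def complEmb {n : ℕ} (i : Fin n) : Fin (n - 1) ↪o Fin n :=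
  ({i}ᶜ : Finset (Fin n)).orderEmbOfFin (by simp [Finset.card_compl])

/-- The antipode on generators: `S(t_{ij}) = (-q)^{i-j} ξ^{j^c}_{i^c} det_q⁻¹`. -/
def antipodeT {n : ℕ} (q : ℝ) (i j : Fin n) : Aq n q :=
  (-(q : ℂ)) ^ ((i : ℤ) - (j : ℤ)) • (qMinor q (t q) (complEmb j) (complEmb i) * detInv n q)

/-- The `*`-structure on generators: `t_{ij}^* = S(t_{ji})`. -/
def tStar {n : ℕ} (q : ℝ) (i j : Fin n) : Aq n q := antipodeT q j i

/-! ### Restriction to the torus and weights -/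

/-- The algebra `A(𝕋) = ℂ[z₁^{±1}, …, zₙ^{±1}]` of Laurent polynomials; the monomial `z^μ` is
`AddMonoidAlgebra.single μ 1`, for `μ ∈ P = ℤⁿ`. -/
abbrev Torus (n : ℕ) : Type := AddMonoidAlgebra ℂ (Fin n → ℤ)

/-- `z^μ`. -/
def zPow {n : ℕ} (μ : Fin n → ℤ) : Torus n := AddMonoidAlgebra.single μ 1

/-- The restriction on generators: `t_{ij} ↦ δ_{ij} z_i`, `det_q⁻¹ ↦ (z₁ ⋯ zₙ)⁻¹`. -/
def resGen (n : ℕ) : Gen n → Torus n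
  | Gen.t i j => if i = j then zPow (Pi.single i 1) else 0
  | Gen.d => zPow (fun _ => -1)

theorem zPow_mul {n : ℕ} (μ ν : Fin n → ℤ) : zPow μ * zPow ν = zPow (μ + ν) := by
  simp [zPow, AddMonoidAlgebra.single_mul_single]

theorem prod_zPow {n : ℕ} (s : Finset (Fin n)) (μ : Fin n → Fin n → ℤ) :
    ∏ i ∈ s, zPow (μ i) = zPow (∑ i ∈ s, μ i) := by
  classical
  induction s using Finset.induction_on with
  | empty => simp [zPow, AddMonoidAlgebra.one_def]
  | insert a s ha ih => rw [Finset.prod_insert ha, Finset.sum_insert ha, ih, zPow_mul]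

theorem qDet_diag {n : ℕ} (q : ℝ) :
    qDet q (fun i j => if i = j then zPow (Pi.single i 1) else (0 : Torus n))
      = zPow (fun _ => 1) := by
  classical
  unfold qDet qMinor
  rw [Finset.sum_eq_single (1 : Equiv.Perm (Fin n))]
  · have h1 : permLength (1 : Equiv.Perm (Fin n)) = 0 := by
      unfold permLength
      rw [Finset.card_eq_zero, Finset.filter_eq_empty_iff]
      rintro p - ⟨h, h'⟩
      exact absurd h (not_lt.mpr (le_of_lt h'))
    rw [h1, pow_zero, one_smul, List.prod_ofFn]
    simp only [Equiv.Perm.coe_one, id_eq, if_true]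
    rw [prod_zPow]
    congr 1
    funext j
    simp [Finset.sum_apply, Pi.single_apply]
  · intro s _ hs
    obtain ⟨k, hk⟩ : ∃ k, s k ≠ k := by
      by_contra h
      push Not at h
      exact hs (Equiv.ext h)
    rw [List.prod_ofFn, Finset.prod_eq_zero (Finset.mem_univ k), smul_zero]
    simp [Ne.symm hk]
  · simp

theorem map_qDet {n : ℕ} {A B : Type*} [Ring A] [Algebra ℂ A] [Ring B] [Algebra ℂ B] (q : ℝ)
    (f : A →ₐ[ℂ] B) (x : Fin n → Fin n → A) :
    f (qDet q x) = qDet q (fun i j => f (x i j)) := by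
  unfold qDet qMinor
  simp [map_sum, map_list_prod, List.map_ofFn, Function.comp_def]

theorem resGen_rel (n : ℕ) (q : ℝ) ⦃x y : FreeAlgebra ℂ (Gen n)⦄ (h : AqRel n q x y) :
    FreeAlgebra.lift ℂ (resGen n) x = FreeAlgebra.lift ℂ (resGen n) y := by
  have hd : FreeAlgebra.lift ℂ (resGen n)
      (qDet q (fun i j => FreeAlgebra.ι ℂ (Gen.t i j))) = zPow (fun _ => 1) := by
    rw [map_qDet]
    simp only [FreeAlgebra.lift_ι_apply, resGen]
    exact qDet_diag q
  have hz : zPow (fun _ : Fin n => (1 : ℤ)) * zPow (fun _ => -1) = 1 := by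
    rw [zPow_mul]
    have : ((fun _ : Fin n => (1 : ℤ)) + fun _ => -1) = 0 := by funext i; simp
    rw [this]; rfl
  cases h with
  | row k i j h =>
    have h' : i ≠ j := ne_of_lt h
    rw [map_smul]
    by_cases hki : k = i
    · subst hki; simp [resGen, h']
    · simp [resGen, hki]
  | col k i j h =>
    have h' : i ≠ j := ne_of_lt h
    rw [map_smul]
    by_cases hki : i = k
    · subst hki; simp [resGen, h'.symm]
    · simp [resGen, hki]
  | comm i k j l hik hjl => simp [mul_comm]
  | cross i k j l hik hjl =>
    have : i ≠ l ∨ k ≠ j := by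
      by_contra hc
      push Not at hc
      obtain ⟨rfl, rfl⟩ := hc
      exact absurd hik (not_lt.mpr hjl.le)
    rcases this with h | h <;> simp [resGen, h, mul_comm]
  | det_mul_d => rw [map_mul, hd, map_one, FreeAlgebra.lift_ι_apply]; exact hz
  | d_mul_det =>
    rw [map_mul, hd, map_one, FreeAlgebra.lift_ι_apply, mul_comm]; exact hz

/-- The restriction homomorphism `A_q(U) → A(𝕋)`, `t_{ij} ↦ δ_{ij} z_i`. -/
def res (n : ℕ) (q : ℝ) : Aq n q →ₐ[ℂ] Torus n :=
  RingQuot.liftAlgHom ℂ ⟨FreeAlgebra.lift ℂ (resGen n), resGen_rel n q⟩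

/-- The coefficient of `z^μ`. -/
def zCoeff {n : ℕ} (μ : Fin n → ℤ) : Torus n →ₗ[ℂ] ℂ :=
  Finsupp.lapply μ ∘ₗ (AddMonoidAlgebra.coeffLinearEquiv ℂ).toLinearMap

/-- For a right comodule `(M, ρ)` the weight component `v_μ` of `v`, that is the coefficient of
`z^μ` in `(id ⊗ res) (ρ v) = ∑_μ v_μ ⊗ z^μ`. -/
def weightComp {n : ℕ} {q : ℝ} {M : Type*} [AddCommMonoid M] [Module ℂ M]
    (ρ : M →ₗ[ℂ] M ⊗[ℂ] Aq n q) (μ : Fin n → ℤ) : M →ₗ[ℂ] M :=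
  (TensorProduct.rid ℂ M).toLinearMap ∘ₗ
    LinearMap.lTensor M (zCoeff μ ∘ₗ (res n q).toLinearMap) ∘ₗ ρ

/-- The weight vectors of weight `μ` in a right comodule: `(id ⊗ res) (ρ v) = v ⊗ z^μ`. -/
def IsWeightVector {n : ℕ} {q : ℝ} {M : Type*} [AddCommMonoid M] [Module ℂ M]
    (ρ : M →ₗ[ℂ] M ⊗[ℂ] Aq n q) (μ : Fin n → ℤ) (v : M) : Prop :=
  LinearMap.lTensor M (res n q).toLinearMap (ρ v) = v ⊗ₜ[ℂ] zPow μ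

/-- `weightComp` is the projection onto weight components: it picks `v_μ` out of a finite sum of
weight vectors. -/
theorem weightComp_sum {n : ℕ} {q : ℝ} {M : Type*} [AddCommMonoid M] [Module ℂ M]
    (ρ : M →ₗ[ℂ] M ⊗[ℂ] Aq n q) (s : Finset (Fin n → ℤ)) (v : (Fin n → ℤ) → M)
    (hv : ∀ μ ∈ s, IsWeightVector ρ μ (v μ)) (ν : Fin n → ℤ) :
    weightComp ρ ν (∑ μ ∈ s, v μ) = if ν ∈ s then v ν else 0 := by
  classical
  have key : ∀ μ ∈ s, weightComp ρ ν (v μ) = if μ = ν then v μ else 0 := by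
    intro μ hμ
    have h := hv μ hμ
    unfold IsWeightVector at h
    simp only [weightComp, LinearMap.lTensor_comp, LinearMap.comp_apply, h]
    simp [zCoeff, zPow, Finsupp.single_apply]
  rw [map_sum, Finset.sum_congr rfl key, Finset.sum_ite_eq' s ν v]

/-! ### Comodules -/

/-- The right coaction `e_j ↦ ∑_i e_i ⊗ x_{ij}` given by a matrix `x`. -/
def matrixCoaction {n : ℕ} {q : ℝ} {ι M : Type*} [Fintype ι] [AddCommMonoid M] [Module ℂ M]
    (b : Module.Basis ι ℂ M) (x : ι → ι → Aq n q) : M →ₗ[ℂ] M ⊗[ℂ] Aq n q :=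
  b.constr ℂ fun j => ∑ i, b i ⊗ₜ[ℂ] x i j

/-- The tensor product of two right coactions: `v ⊗ w ↦ ∑ v₍₁₎ ⊗ w₍₁₎ ⊗ v₍₂₎ w₍₂₎`. -/
def tensorCoaction {n : ℕ} {q : ℝ} {M N : Type*} [AddCommMonoid M] [Module ℂ M]
    [AddCommMonoid N] [Module ℂ N]
    (ρ : M →ₗ[ℂ] M ⊗[ℂ] Aq n q) (ρ₂ : N →ₗ[ℂ] N ⊗[ℂ] Aq n q) :
    M ⊗[ℂ] N →ₗ[ℂ] (M ⊗[ℂ] N) ⊗[ℂ] Aq n q :=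
  LinearMap.lTensor (M ⊗[ℂ] N) (LinearMap.mul' ℂ (Aq n q)) ∘ₗ
    (TensorProduct.tensorTensorTensorComm ℂ M (Aq n q) N (Aq n q)).toLinearMap ∘ₗ
      TensorProduct.map ρ ρ₂

/-- `f` intertwines the right coactions `ρ` on `M` and `ρ₂` on `N`. -/
def IsIntertwiner {n : ℕ} {q : ℝ} {M N : Type*} [AddCommMonoid M] [Module ℂ M]
    [AddCommMonoid N] [Module ℂ N]
    (ρ : M →ₗ[ℂ] M ⊗[ℂ] Aq n q) (ρ₂ : N →ₗ[ℂ] N ⊗[ℂ] Aq n q) (f : M →ₗ[ℂ] N) : Prop :=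
  ρ₂ ∘ₗ f = LinearMap.rTensor (Aq n q) f ∘ₗ ρ

/-- The vector space `V = ℂⁿ`. -/
abbrev V (n : ℕ) : Type := Fin n → ℂ

/-- The dual space `V^*`. -/
abbrev Vd (n : ℕ) : Type := Module.Dual ℂ (V n)

/-- The canonical basis `(v_i)` of `V`. -/
def bV (n : ℕ) : Module.Basis (Fin n) ℂ (V n) := Pi.basisFun ℂ (Fin n)

/-- The dual basis `(v_i^*)` of `V^*`. -/
def bVd (n : ℕ) : Module.Basis (Fin n) ℂ (Vd n) := (bV n).dualBasis

/-- The basis `v_i ⊗ v_j^*` of `V ⊗ V^*`. -/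
def bVVd (n : ℕ) : Module.Basis (Fin n × Fin n) ℂ (V n ⊗[ℂ] Vd n) := (bV n).tensorProduct (bVd n)

/-- The tensor power `(V ⊗ V^*)^{⊗ r}`. -/
abbrev Src (n r : ℕ) : Type := PiTensorProduct ℂ fun _ : Fin r => V n ⊗[ℂ] Vd n

/-- The basis `(v_{a₁} ⊗ v_{b₁}^*) ⊗ ⋯ ⊗ (v_{aᵣ} ⊗ v_{bᵣ}^*)` of `(V ⊗ V^*)^{⊗ r}`. -/
def bSrc (n r : ℕ) : Module.Basis (Fin r → Fin n × Fin n) ℂ (Src n r) :=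
  Basis.piTensorProduct fun _ => bVVd n

/-- The tensor product coaction on `(V ⊗ V^*)^{⊗ r}`: the matrix coefficients of a tensor product
are the products, in the order of the factors, of those of the factors `V, V^*, V, V^*, …`, where
`V` is the vector corepresentation `v_j ↦ ∑_i v_i ⊗ t_{ij}` and `V^*` its contragredient
`v_j^* ↦ ∑_i v_i^* ⊗ t_{ij}^*`. -/
def coactSrc (n : ℕ) (q : ℝ) (r : ℕ) : Src n r →ₗ[ℂ] Src n r ⊗[ℂ] Aq n q :=
  matrixCoaction (bSrc n r) fun y x =>
    (List.ofFn fun k : Fin r => t q (y k).1 (x k).1 * tStar q (y k).2 (x k).2).prod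

/-! ### The exterior algebras -/

/-- The relations of `Λ_q(V)`. -/
inductive LRel (n : ℕ) (q : ℝ) : FreeAlgebra ℂ (Fin n) → FreeAlgebra ℂ (Fin n) → Prop
  | sq (i : Fin n) : LRel n q (FreeAlgebra.ι ℂ i * FreeAlgebra.ι ℂ i) 0
  | swap (i j : Fin n) (h : i < j) :
      LRel n q (FreeAlgebra.ι ℂ i * FreeAlgebra.ι ℂ j)
        ((-(q : ℂ)⁻¹) • (FreeAlgebra.ι ℂ j * FreeAlgebra.ι ℂ i))

/-- The relations of `Λ_q(V^*)`. -/
inductive LdRel (n : ℕ) (q : ℝ) : FreeAlgebra ℂ (Fin n) → FreeAlgebra ℂ (Fin n) → Prop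
  | sq (i : Fin n) : LdRel n q (FreeAlgebra.ι ℂ i * FreeAlgebra.ι ℂ i) 0
  | swap (i j : Fin n) (h : i < j) :
      LdRel n q (FreeAlgebra.ι ℂ j * FreeAlgebra.ι ℂ i)
        ((-(q : ℂ)⁻¹) • (FreeAlgebra.ι ℂ i * FreeAlgebra.ι ℂ j))

/-- The exterior algebra `Λ_q(V)`. -/
abbrev L (n : ℕ) (q : ℝ) : Type := RingQuot (LRel n q)

/-- The exterior algebra `Λ_q(V^*)`. -/
abbrev Ld (n : ℕ) (q : ℝ) : Type := RingQuot (LdRel n q)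

/-- The generators `v_i` of `Λ_q(V)`. -/
def lv {n : ℕ} (q : ℝ) (i : Fin n) : L n q := RingQuot.mkAlgHom ℂ (LRel n q) (FreeAlgebra.ι ℂ i)

/-- The generators `v_i^*` of `Λ_q(V^*)`. -/
def ldv {n : ℕ} (q : ℝ) (i : Fin n) : Ld n q :=
  RingQuot.mkAlgHom ℂ (LdRel n q) (FreeAlgebra.ι ℂ i)

/-- The product `v_{a₁} ∧ ⋯ ∧ v_{aᵣ}`. -/
def lword {n r : ℕ} (q : ℝ) (a : Fin r → Fin n) : L n q := (List.ofFn fun k => lv q (a k)).prod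

/-- The product `v_{a₁}^* ∧ ⋯ ∧ v_{aᵣ}^*`. -/
def ldword {n r : ℕ} (q : ℝ) (a : Fin r → Fin n) : Ld n q := (List.ofFn fun k => ldv q (a k)).prod

/-- The component `Λ_q^r(V)` of degree `r`. -/
def LPow (n : ℕ) (q : ℝ) (r : ℕ) : Submodule ℂ (L n q) :=
  Submodule.span ℂ (Set.range fun a : Fin r → Fin n => lword q a)

/-- The component `Λ_q^r(V^*)` of degree `r`. -/
def LdPow (n : ℕ) (q : ℝ) (r : ℕ) : Submodule ℂ (Ld n q) :=
  Submodule.span ℂ (Set.range fun a : Fin r → Fin n => ldword q a)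

/-- `v_I = v_{i₁} ∧ ⋯ ∧ v_{iᵣ}` for `I = {i₁ < ⋯ < iᵣ}`. -/
def vI {n : ℕ} (q : ℝ) (I : Finset (Fin n)) : L n q :=
  ((I.sort (· ≤ ·)).map (lv q)).prod

/-- `v_I^* = v_{iᵣ}^* ∧ ⋯ ∧ v_{i₁}^*` for `I = {i₁ < ⋯ < iᵣ}`. -/
def vdI {n : ℕ} (q : ℝ) (I : Finset (Fin n)) : Ld n q :=
  ((I.sort (· ≤ ·)).reverse.map (ldv q)).prod

/-- An algebra homomorphism `Λ_q(V) → Λ_q(V) ⊗ A_q(U)` is the coaction on `Λ_q(V)` if it extends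
the coaction `v_j ↦ ∑_i v_i ⊗ t_{ij}` of `V`. There is at most one such homomorphism. -/
def IsCoactionL {n : ℕ} {q : ℝ} (ρ : L n q →ₐ[ℂ] L n q ⊗[ℂ] Aq n q) : Prop :=
  ∀ j, ρ (lv q j) = ∑ i, lv q i ⊗ₜ[ℂ] t q i j

/-- An algebra homomorphism `Λ_q(V^*) → Λ_q(V^*) ⊗ A_q(U)` is the coaction on `Λ_q(V^*)` if it
extends the coaction `v_j^* ↦ ∑_i v_i^* ⊗ t_{ij}^*` of `V^*`. There is at most one such
homomorphism. -/
def IsCoactionLd {n : ℕ} {q : ℝ} (ρ : Ld n q →ₐ[ℂ] Ld n q ⊗[ℂ] Aq n q) : Prop :=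
  ∀ j, ρ (ldv q j) = ∑ i, ldv q i ⊗ₜ[ℂ] tStar q i j

theorem IsCoactionL.unique {n : ℕ} {q : ℝ} {ρ ρ₂ : L n q →ₐ[ℂ] L n q ⊗[ℂ] Aq n q}
    (h : IsCoactionL ρ) (h₂ : IsCoactionL ρ₂) : ρ = ρ₂ := by
  apply RingQuot.ringQuot_ext'
  apply FreeAlgebra.hom_ext
  funext j
  exact (h j).trans (h₂ j).symm

theorem IsCoactionLd.unique {n : ℕ} {q : ℝ} {ρ ρ₂ : Ld n q →ₐ[ℂ] Ld n q ⊗[ℂ] Aq n q}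
    (h : IsCoactionLd ρ) (h₂ : IsCoactionLd ρ₂) : ρ = ρ₂ := by
  apply RingQuot.ringQuot_ext'
  apply FreeAlgebra.hom_ext
  funext j
  exact (h j).trans (h₂ j).symm

/-! ### The map `Ψ̂_r` -/

/-- The tensor power `V^{⊗ r}`. -/
abbrev VPow (n r : ℕ) : Type := PiTensorProduct ℂ fun _ : Fin r => V n

/-- The tensor power `(V^*)^{⊗ r}`. -/
abbrev VdPow (n r : ℕ) : Type := PiTensorProduct ℂ fun _ : Fin r => Vd n

/-- The basis `v_{a₁} ⊗ ⋯ ⊗ v_{aᵣ}` of `V^{⊗ r}`. -/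
def bVPow (n r : ℕ) : Module.Basis (Fin r → Fin n) ℂ (VPow n r) :=
  Basis.piTensorProduct fun _ => bV n

/-- The basis `v_{a₁}^* ⊗ ⋯ ⊗ v_{aᵣ}^*` of `(V^*)^{⊗ r}`. -/
def bVdPow (n r : ℕ) : Module.Basis (Fin r → Fin n) ℂ (VdPow n r) :=
  Basis.piTensorProduct fun _ => bVd n

/-- The basis `v_{a₁} ⊗ ⋯ ⊗ v_{aᵣ} ⊗ v_{b₁}^* ⊗ ⋯ ⊗ v_{bᵣ}^*` of `V^{⊗ r} ⊗ (V^*)^{⊗ r}`. -/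
def bMix (n r : ℕ) :
    Module.Basis ((Fin r → Fin n) × (Fin r → Fin n)) ℂ (VPow n r ⊗[ℂ] VdPow n r) :=
  (bVPow n r).tensorProduct (bVdPow n r)

/-- The map `β : V^* ⊗ V → V ⊗ V^*`,
`β(v_i^* ⊗ v_j) = q^{-δ_{ij}} v_j ⊗ v_i^* + (q⁻¹ - q) δ_{ij} ∑_{k<j} v_k ⊗ v_k^*`. -/
def beta (n : ℕ) (q : ℝ) : Vd n ⊗[ℂ] V n →ₗ[ℂ] V n ⊗[ℂ] Vd n :=
  ((bVd n).tensorProduct (bV n)).constr ℂ fun p =>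
    (if p.1 = p.2 then (q : ℂ)⁻¹ else 1) • (bV n p.2 ⊗ₜ[ℂ] bVd n p.1)
      + (if p.1 = p.2 then (q : ℂ)⁻¹ - (q : ℂ) else 0) •
        ∑ k ∈ Finset.univ.filter (fun k => k < p.2), bV n k ⊗ₜ[ℂ] bVd n k

/-- The map `β_{ij}`, which applies `β` to the factors `V_i^* ⊗ V_j` and is the identity on all
other factors. A tensor product of the labelled factors `V_1, …, V_r, V_1^*, …, V_r^*`, in whatever
order they stand, is identified with `(V_1 ⊗ ⋯ ⊗ V_r) ⊗ (V_1^* ⊗ ⋯ ⊗ V_r^*)` by rearranging the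
factors, so that `β_{ij}` becomes an endomorphism of that space. -/
def betaAt (n : ℕ) (q : ℝ) {r : ℕ} (i j : Fin r) : Module.End ℂ (VPow n r ⊗[ℂ] VdPow n r) :=
  (bMix n r).constr ℂ fun p =>
    ∑ k, ∑ m, (bVVd n).repr (beta n q (bVd n (p.2 i) ⊗ₜ[ℂ] bV n (p.1 j))) (k, m) •
      bMix n r (Function.update p.1 j k, Function.update p.2 i m)

/-- The rearrangement of factors
`(V_1 ⊗ V_1^*) ⊗ ⋯ ⊗ (V_r ⊗ V_r^*) ≃ (V_1 ⊗ ⋯ ⊗ V_r) ⊗ (V_1^* ⊗ ⋯ ⊗ V_r^*)`. -/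
def regroup (n r : ℕ) : Src n r ≃ₗ[ℂ] VPow n r ⊗[ℂ] VdPow n r :=
  (bSrc n r).equiv (bMix n r) 
    (Equiv.arrowProdEquivProdArrow (Fin r) (fun _ => Fin n) (fun _ => Fin n))

/-- `Ψ_r = (β_{1r} ∘ ⋯ ∘ β_{r-1,r}) ∘ ⋯ ∘ (β_{13} ∘ β_{23}) ∘ β_{12}`. -/
def Psi (n : ℕ) (q : ℝ) (r : ℕ) : Src n r →ₗ[ℂ] VPow n r ⊗[ℂ] VdPow n r :=
  (((List.finRange r).reverse.map fun j =>
      (((List.finRange r).filter fun i => i < j).map fun i => betaAt n q i j).prod).prod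
    : Module.End ℂ (VPow n r ⊗[ℂ] VdPow n r)) ∘ₗ (regroup n r).toLinearMap

/-- The canonical projection `V^{⊗ r} → Λ_q^r(V)`. -/
def pr (n : ℕ) (q : ℝ) (r : ℕ) : VPow n r →ₗ[ℂ] LPow n q r :=
  (bVPow n r).constr ℂ fun a => ⟨lword q a, Submodule.subset_span ⟨a, rfl⟩⟩

/-- The canonical projection `(V^*)^{⊗ r} → Λ_q^r(V^*)`. -/
def prd (n : ℕ) (q : ℝ) (r : ℕ) : VdPow n r →ₗ[ℂ] LdPow n q r :=
  (bVdPow n r).constr ℂ fun a => ⟨ldword q a, Submodule.subset_span ⟨a, rfl⟩⟩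

/-- `Ψ̂_r = (pr_r ⊗ pr_r^*) ∘ Ψ_r`. -/
def PsiHat (n : ℕ) (q : ℝ) (r : ℕ) : Src n r →ₗ[ℂ] LPow n q r ⊗[ℂ] LdPow n q r :=
  TensorProduct.map (pr n q r) (prd n q r) ∘ₗ Psi n q r

/-- The inclusion of `Λ_q^r(V) ⊗ Λ_q^r(V^*)` in `Λ_q(V) ⊗ Λ_q(V^*)`. -/
def incl (n : ℕ) (q : ℝ) (r : ℕ) : LPow n q r ⊗[ℂ] LdPow n q r →ₗ[ℂ] L n q ⊗[ℂ] Ld n q :=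
  TensorProduct.mapIncl (LPow n q r) (LdPow n q r)

/-! ### Principal terms and the vectors of the theorem -/

/-- The weight `ν^♭ = (ν₁, …, ν_l, 0, …, 0, -ν_l, …, -ν₁) ∈ ℤⁿ` for `ν ∈ ℤ^l`. -/
def flat (n : ℕ) {l : ℕ} (ν : Fin l → ℤ) (i : Fin n) : ℤ :=
  if h : (i : ℕ) < l then ν ⟨i, h⟩
  else if h : (i.rev : ℕ) < l then -ν ⟨i.rev, h⟩ else 0

/-- The orbit `𝒲(1^r)` in `ℤ^l` under permutations and sign changes,
`(1^r) = (1, …, 1, 0, …, 0)` with `r` ones. -/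
def orbit (l r : ℕ) : Finset (Fin l → ℤ) :=
  (Finset.univ : Finset ((Fin l → ℤˣ) × Equiv.Perm (Fin l))).image fun w i =>
    (w.1 i : ℤ) * (if (w.2 i : ℕ) < r then 1 else 0)

/-- The principal term `[v] = ∑_{ν ∈ 𝒲(1^r)} v_{ν^♭}`. -/
def principalTerm {n : ℕ} {q : ℝ} {M : Type*} [AddCommMonoid M] [Module ℂ M]
    (ρ : M →ₗ[ℂ] M ⊗[ℂ] Aq n q) (l r : ℕ) (v : M) : M :=
  ∑ ν ∈ orbit l r, weightComp ρ (flat n ν) v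

/-- The matrix `J^σ`; here `k' = n + 1 - k` is `Fin.rev`. -/
def J (n l : ℕ) (q σ : ℝ) (i j : Fin n) : ℝ :=
  (if i = j ∧ (i : ℕ) < l then 1 - q ^ (2 * σ) else 0)
    + (if i = j ∧ l ≤ (i : ℕ) ∧ (i : ℕ) < n - l then 1 else 0)
    - (if j = i.rev ∧ (i : ℕ) < l then q ^ σ else 0)
    - (if i = j.rev ∧ (j : ℕ) < l then q ^ σ else 0)

/-- The matrix `J̃^σ`. Since indices start at `0` here, the entry `i` stands for `k = i + 1`. -/
def Jt (n l : ℕ) (q σ : ℝ) (i j : Fin n) : ℝ :=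
  (if i = j ∧ (i : ℕ) < l then 1 - q ^ (2 * ((n : ℤ) - 2 * (l : ℤ))) * q ^ (2 * σ) else 0)
    + (if i = j ∧ l ≤ (i : ℕ) ∧ (i : ℕ) < n - l then 1 else 0)
    - (if j = i.rev ∧ (i : ℕ) < l then
        q ^ (σ - 1) * q ^ (2 * (((i : ℕ) : ℤ) + 1 - (l : ℤ))) else 0)
    - (if i = j.rev ∧ (j : ℕ) < l then
        q ^ (σ - 1) * q ^ (2 * (((i : ℕ) : ℤ) + 1 - (l : ℤ))) else 0)

/-- `∑_{ij} X_{ij} v_i ⊗ v_j^*`. -/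
def vecOf {n : ℕ} (X : Fin n → Fin n → ℝ) : V n ⊗[ℂ] Vd n :=
  ∑ i, ∑ j, (X i j : ℂ) • (bV n i ⊗ₜ[ℂ] bVd n j)

/-- `w^σ`. -/
def w (n l : ℕ) (q σ : ℝ) : V n ⊗[ℂ] Vd n := vecOf (J n l q σ)

/-- `w̃^σ`. -/
def wt (n l : ℕ) (q σ : ℝ) : V n ⊗[ℂ] Vd n := vecOf (Jt n l q σ)

/-- `x^{⊗ r}`. -/
def pow {n : ℕ} (r : ℕ) (x : V n ⊗[ℂ] Vd n) : Src n r := PiTensorProduct.tprod ℂ fun _ => x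

/-- The sets `I ⊂ [1,l] ∪ [l',n]` with `|I| = r` and `I ∩ I' = ∅`. -/
def idx (n l r : ℕ) : Finset (Finset (Fin n)) :=
  Finset.univ.filter fun I =>
    (∀ i ∈ I, (i : ℕ) < l ∨ (i.rev : ℕ) < l) ∧ I.card = r ∧ I ∩ I.image Fin.rev = ∅

/-- `⟨2ρ, ε_I⟩` for `ρ = ∑_k (n - k) ε_k`; the entry `i` stands for `k = i + 1`. -/
def twoRho {n : ℕ} (I : Finset (Fin n)) : ℤ :=
  ∑ i ∈ I, 2 * ((n : ℤ) - (((i : ℕ) : ℤ) + 1))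

/-- `u_r = ∑_I v_I ⊗ v_{I'}^*`. -/
def u (n l : ℕ) (q : ℝ) (r : ℕ) : L n q ⊗[ℂ] Ld n q :=
  ∑ I ∈ idx n l r, vI q I ⊗ₜ[ℂ] vdI q (I.image Fin.rev)

/-- `ũ_r = ∑_I q^{⟨2ρ, ε_{I'}⟩} v_I ⊗ v_{I'}^*`. -/
def ut (n l : ℕ) (q : ℝ) (r : ℕ) : L n q ⊗[ℂ] Ld n q :=
  ∑ I ∈ idx n l r,
    ((q : ℂ) ^ twoRho (I.image Fin.rev)) • (vI q I ⊗ₜ[ℂ] vdI q (I.image Fin.rev))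

/-- The `q`-shifted factorial `(a; p)_m = ∏_{j < m} (1 - p^j a)`. -/
def qPoch (a p : ℝ) (m : ℕ) : ℝ := ∏ j ∈ Finset.range m, (1 - p ^ j * a)

/-- `c_r(σ) = (q^σ / (q² - 1))^r (q²; q²)_r`. -/
def c (q : ℝ) (r : ℕ) (σ : ℝ) : ℝ := (q ^ σ / (q ^ 2 - 1)) ^ r * qPoch (q ^ 2) (q ^ 2) r

/-- `c̃_r(σ) = (q^{σ-1} q^{2(1-l)} / (q² - 1))^r (q²; q²)_r`. -/
def ct (l : ℕ) (q : ℝ) (r : ℕ) (σ : ℝ) : ℝ :=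
  (q ^ (σ - 1) * q ^ (2 * (1 - (l : ℤ))) / (q ^ 2 - 1)) ^ r * qPoch (q ^ 2) (q ^ 2) r

end QGrass

end

namespace QGrass

/-! The defining relations of `A_q(U)`, written in RTT form with the coefficients of `β` on both
sides, allow the generating matrix to be cancelled by its inverse. Cancelling it once on each side
says exactly that `β : V^* ⊗ V → V ⊗ V^*` commutes with the coactions (`exchange_mixed`). Cancelling
further shows that the contragredient matrix is again a quantum matrix (`IsQuantumMatrix.inverse`),
whence the coaction on `Λ_q(V^*)`. That the antipode given by minors really inverts `t` comes from
the quantum Laplace expansions, read off in the top degree of `Λ_q(V)`. As a composite of maps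
`β_{ij}` and projections, `Ψ̂_r` is then an intertwiner. It is surjective since `β` is triangular
with invertible diagonal.

An intertwiner commutes with weight components, so the principal term is the image of the relevant
weight part of `w^{⊗ r}`. The weight `ν^♭` has `r` entries `1`, and a tensor of `r` factors `v_i ⊗
v_j^*` can reach it only if every factor is antidiagonal, `j = i'`, with the `i` distinct and
forming a set `I` disjoint from `I'` (`exists_word_of_srcWeight`). The diagonal of `J` is thus
irrelevant. On these tensors no `V^*` index equals a `V` index, so every `β_{ij}` is a mere flip and
the image is a product of the elements `e_i = v_i ⊗ v_{i'}^*` in `Λ_q(V) ⊗ Λ_q(V^*)`.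

These satisfy `e_i² = 0` and `e_j e_i = q² e_i e_j` for `i < j`, so summing over the orderings of
`I` gives the `q²`-factorial of `r` times `v_I ⊗ v_{I'}^*` (`IsExterior.sum_words`). Multiplying by
the antidiagonal entries of `J` or `J̃` yields the constants. -/

theorem eq_sum_of_left_inverse {n : ℕ} {A : Type*} [Ring A] {x s : Fin n → Fin n → A}
    (hs : ∀ i k, ∑ j, s i j * x j k = if i = k then 1 else 0) {f g : Fin n → A}
    (h : ∀ p, ∑ i, x p i * f i = g p) (a : Fin n) : f a = ∑ p, s a p * g p := by
  simp_rw [← h, Finset.mul_sum, ← mul_assoc]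
  rw [Finset.sum_comm]
  simp_rw [← Finset.sum_mul, hs]
  simp

theorem eq_sum_of_right_inverse {n : ℕ} {A : Type*} [Ring A] {x s : Fin n → Fin n → A}
    (hs : ∀ i k, ∑ j, x i j * s j k = if i = k then 1 else 0) {f g : Fin n → A}
    (h : ∀ y, g y = ∑ m, f m * x m y) (z : Fin n) : ∑ y, g y * s y z = f z := by
  simp_rw [h, Finset.sum_mul, mul_assoc]
  rw [Finset.sum_comm]
  simp_rw [← Finset.mul_sum, hs]
  simp

/-! ### Quantum matrices, the RTT relations and the inverse matrix. -/

section QuantumMatrix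

variable {n : ℕ} {A : Type*} [Ring A] [Algebra ℂ A]

/-- The commutation relations of the entries of a quantum matrix. -/
structure IsQuantumMatrix (q : ℂ) (x : Fin n → Fin n → A) : Prop where
  row : ∀ k i j, i < j → x k i * x k j = q • (x k j * x k i)
  col : ∀ k i j, i < j → x i k * x j k = q • (x j k * x i k)
  comm : ∀ i k j m, i < k → j < m → x i m * x k j = x k j * x i m
  cross : ∀ i k j m, i < k → j < m →
    x i j * x k m = x k m * x i j + (q - q⁻¹) • (x i m * x k j)

theorem IsQuantumMatrix.transpose {q : ℂ} {x : Fin n → Fin n → A} (h : IsQuantumMatrix q x) :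
    IsQuantumMatrix q fun i j => x j i where
  row k i j hij := h.col k i j hij
  col k i j hij := h.row k i j hij
  comm i k j m hik hjm := (h.comm j m i k hjm hik).symm
  cross i k j m hik hjm := by
    rw [h.cross j m i k hjm hik, h.comm j m i k hjm hik]

/-- The coefficient of `v_k ⊗ v_m^*` in `β (v_i^* ⊗ v_j)`. -/
noncomputable def betaCoef (q : ℂ) (i j k m : Fin n) : ℂ :=
  (if i = j then q⁻¹ else 1) * (if k = j ∧ m = i then 1 else 0)
    + (if i = j ∧ k = m ∧ k < j then q⁻¹ - q else 0)

/-- With two of the four indices fixed, only the flip term and the single term with equal source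
indices survive; this contraction and the next are the two sides of the RTT relation. -/
theorem sum_betaCoef_left (q : ℂ) (j y : Fin n) (f : Fin n → Fin n → A) :
    ∑ i, ∑ c, betaCoef q i j c y • f i c =
      (if y = j then q⁻¹ else 1) • f y j + (if y < j then q⁻¹ - q else 0) • f j y := by
  simp only [betaCoef, add_smul, Finset.sum_add_distrib]
  congr 1
  · rw [Finset.sum_eq_single y, Finset.sum_eq_single j]
    · simp
    · intro c _ hc; simp [hc]
    · simp
    · intro i _ hi; simp [Ne.symm hi]
    · simp
  · rw [Finset.sum_eq_single j, Finset.sum_eq_single y]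
    · simp
    · intro c _ hc; simp [hc]
    · simp
    · intro i _ hi; simp [hi]
    · simp

theorem sum_betaCoef_right (q : ℂ) (p k : Fin n) (f : Fin n → Fin n → A) :
    ∑ b, ∑ m, betaCoef q p b k m • f b m =
      (if p = k then q⁻¹ else 1) • f k p + (if k < p then q⁻¹ - q else 0) • f p k := by
  simp only [betaCoef, add_smul, Finset.sum_add_distrib]
  congr 1
  · rw [Finset.sum_eq_single k, Finset.sum_eq_single p]
    · simp
    · intro c _ hc; simp [hc]
    · simp
    · intro i _ hi; simp [Ne.symm hi]
    · simp
  · rw [Finset.sum_eq_single p, Finset.sum_eq_single k]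
    · simp
    · intro c _ hc; simp [Ne.symm hc]
    · simp
    · intro i _ hi; simp [Ne.symm hi]
    · simp

/-- The RTT form of the relations. The relative orders of `p, k` and of `y, j` give nine cases, each
a consequence of one or two defining relations; the all-equal case is trivial. -/
theorem IsQuantumMatrix.exchange {q : ℂ} (hq : q ≠ 0) {x : Fin n → Fin n → A}
    (h : IsQuantumMatrix q x) (p j k y : Fin n) :
    (if y = j then q⁻¹ else 1) • (x p y * x k j) + (if y < j then q⁻¹ - q else 0) • (x p j * x k y)
    = (if p = k then q⁻¹ else 1) • (x k j * x p y)
      + (if k < p then q⁻¹ - q else 0) • (x p j * x k y) := by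
  rcases lt_trichotomy p k with hpk | rfl | hpk <;> rcases lt_trichotomy y j with hyj | rfl | hyj
  · simp only [hpk.ne, hpk.not_gt, hyj.ne, hyj, if_true, if_false, one_smul, zero_smul, add_zero]
    rw [h.cross p k y j hpk hyj]; module
  · simp only [hpk.ne, hpk.not_gt, lt_irrefl, if_true, if_false, one_smul, zero_smul, add_zero]
    rw [h.col y p k hpk, smul_smul, inv_mul_cancel₀ hq, one_smul]
  · simp only [hpk.ne, hpk.not_gt, hyj.ne', hyj.not_gt, if_false, one_smul, zero_smul, add_zero]
    rw [h.comm p k j y hpk hyj]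
  · simp only [lt_irrefl, hyj.ne, hyj, if_true, if_false, one_smul, zero_smul, add_zero]
    rw [h.row p y j hyj]; module
  · simp
  · simp only [lt_irrefl, hyj.ne', hyj.not_gt, if_true, if_false, one_smul, zero_smul, add_zero]
    rw [h.row p j y hyj, smul_smul, inv_mul_cancel₀ hq, one_smul]
  · simp only [hpk.ne', hpk, hyj.ne, hyj, if_true, if_false, one_smul]
    rw [h.comm k p y j hpk hyj]
  · simp only [hpk.ne', hpk, lt_irrefl, if_true, if_false, one_smul, zero_smul, add_zero]
    rw [h.col y k p hpk, ← add_smul, add_sub_cancel]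
  · simp only [hpk.ne', hpk, hyj.ne', hyj.not_gt, if_true, if_false, one_smul, zero_smul, add_zero]
    rw [h.cross k p j y hpk hyj, h.comm k p j y hpk hyj]; module

theorem IsQuantumMatrix.of_exchange {q : ℂ} (hq : q ≠ 0) {x : Fin n → Fin n → A}
    (h : ∀ p j k y, (if y = j then q⁻¹ else 1) • (x p y * x k j)
        + (if y < j then q⁻¹ - q else 0) • (x p j * x k y)
      = (if p = k then q⁻¹ else 1) • (x k j * x p y)
        + (if k < p then q⁻¹ - q else 0) • (x p j * x k y)) :
    IsQuantumMatrix q x where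
  row k i j hij := by
    have := h k i k j
    simp only [hij.ne', hij.not_gt, lt_irrefl, if_true, if_false, one_smul, zero_smul,
      add_zero] at this
    rw [this, smul_smul, mul_inv_cancel₀ hq, one_smul]
  col k i j hij := by
    have := h i k j k
    simp only [hij.ne, hij.not_gt, lt_irrefl, if_true, if_false, one_smul, zero_smul,
      add_zero] at this
    rw [← this, smul_smul, mul_inv_cancel₀ hq, one_smul]
  comm i k j m hik hjm := by
    have := h i j k m
    simpa only [hik.ne, hik.not_gt, hjm.ne', hjm.not_gt, if_false, one_smul, zero_smul,
      add_zero] using this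
  cross i k j m hik hjm := by
    have := h i m k j
    simp only [hik.ne, hik.not_gt, hjm.ne, hjm, if_true, if_false, one_smul, zero_smul,
      add_zero] at this
    rw [← this]; module

section Inverse

variable {x s : Fin n → Fin n → A}

variable {B : Fin n → Fin n → Fin n → Fin n → ℂ}

/-- The first matrix factor on the left-hand side is cancelled by multiplying with `s` on the left.
-/
theorem exchange_left
    (hl : ∀ i k, ∑ j, s i j * x j k = if i = k then 1 else 0)
    (h : ∀ p j k y, ∑ i, ∑ c, B i j c y • (x p i * x k c) = ∑ b, ∑ m, B p b k m • (x b j * x m y))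
    (a j k y : Fin n) :
    ∑ c, B a j c y • x k c = ∑ m, (∑ p, ∑ b, B p b k m • (s a p * x b j)) * x m y := by
  have := eq_sum_of_left_inverse hl (f := fun i => ∑ c, B i j c y • x k c)
    (g := fun p => ∑ b, ∑ m, B p b k m • (x b j * x m y)) (fun p => by
      rw [← h]; simp_rw [Finset.mul_sum, mul_smul_comm]) a
  rw [this]
  simp_rw [Finset.mul_sum, Finset.sum_mul, mul_smul_comm, smul_mul_assoc, ← mul_assoc]
  rw [Finset.sum_comm' (t' := Finset.univ) (s' := fun _ => Finset.univ) (by simp)]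
  conv_lhs => enter [2, b]; rw [Finset.sum_comm]
  rw [Finset.sum_comm]
  refine Finset.sum_congr rfl fun m _ => Finset.sum_comm

/-- Cancelling also the last factor on the right leaves one `x` and one `s` on each side. With `B`
the coefficients of `β` and `s` the antipode, this is the intertwining property of `β`. -/
theorem exchange_mixed
    (hl : ∀ i k, ∑ j, s i j * x j k = if i = k then 1 else 0)
    (hr : ∀ i k, ∑ j, x i j * s j k = if i = k then 1 else 0)
    (h : ∀ p j k y, ∑ i, ∑ c, B i j c y • (x p i * x k c) = ∑ b, ∑ m, B p b k m • (x b j * x m y))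
    (a j k z : Fin n) :
    ∑ c, ∑ y, B a j c y • (x k c * s y z) = ∑ p, ∑ b, B p b k z • (s a p * x b j) := by
  rw [← eq_sum_of_right_inverse hr (exchange_left hl h a j k) z, Finset.sum_comm]
  simp_rw [Finset.sum_mul, smul_mul_assoc]

/-- All factors `x` are cancelled from the RTT relation, which leaves a quadratic relation among the
entries of `s` alone. -/
theorem exchange_inverse
    (hl : ∀ i k, ∑ j, s i j * x j k = if i = k then 1 else 0)
    (hr : ∀ i k, ∑ j, x i j * s j k = if i = k then 1 else 0)
    (h : ∀ p j k y, ∑ i, ∑ c, B i j c y • (x p i * x k c) = ∑ b, ∑ m, B p b k m • (x b j * x m y))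
    (a b z w : Fin n) :
    ∑ j, ∑ y, B a j b y • (s y z * s j w) = ∑ p, ∑ k, B p w k z • (s b k * s a p) := by
  have h1 : ∀ j, ∑ y, B a j b y • s y z =
      ∑ b', (∑ p, ∑ k, B p b' k z • (s b k * s a p)) * x b' j := by
    intro j
    -- The coefficients are regarded as central elements of `A`, so that `exchange_left` reads as
    -- `x` applied to the vector `c ↦ B a j c y` and can be inverted.
    have h2 : ∀ y, algebraMap ℂ A (B a j b y) =
        ∑ m, (∑ b', (∑ p, ∑ k, B p b' k m • (s b k * s a p)) * x b' j) * x m y := by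
      intro y
      rw [eq_sum_of_left_inverse hl (f := fun c => algebraMap ℂ A (B a j c y))
        (g := fun k => ∑ m, (∑ p, ∑ b', B p b' k m • (s a p * x b' j)) * x m y) (fun k => by
          rw [← exchange_left hl h]
          simp_rw [Algebra.smul_def, Algebra.commutes]) b]
      simp_rw [Finset.mul_sum, Finset.sum_mul, Finset.mul_sum, smul_mul_assoc, mul_smul_comm,
        ← mul_assoc]
      rw [Finset.sum_comm]
      refine Finset.sum_congr rfl fun m _ => ?_
      rw [Finset.sum_comm' (t' := Finset.univ) (s' := fun _ => Finset.univ) (by simp)]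
      conv_lhs => enter [2, p]; rw [Finset.sum_comm]
      rw [Finset.sum_comm]
    rw [← eq_sum_of_right_inverse hr h2 z]
    simp_rw [Algebra.smul_def]
  rw [← eq_sum_of_right_inverse hr h1 w]
  simp_rw [Finset.sum_mul, smul_mul_assoc]

theorem IsQuantumMatrix.exchange_sum {q : ℂ} (hq : q ≠ 0) (h : IsQuantumMatrix q x)
    (p j k y : Fin n) :
    ∑ i, ∑ c, betaCoef q i j c y • (x p i * x k c)
      = ∑ b, ∑ m, betaCoef q p b k m • (x b j * x m y) := by
  rw [sum_betaCoef_left q j y (fun i c => x p i * x k c),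
    sum_betaCoef_right q p k (fun b m => x b j * x m y)]
  exact h.exchange hq p j k y

/-- The inverse satisfies the relations with `q` replaced by `q⁻¹`; reversing the order of the
indices restores `q`, and transposing preserves the relations. -/
theorem IsQuantumMatrix.inverse {q : ℂ} (hq : q ≠ 0) (h : IsQuantumMatrix q x)
    (hl : ∀ i k, ∑ j, s i j * x j k = if i = k then 1 else 0)
    (hr : ∀ i k, ∑ j, x i j * s j k = if i = k then 1 else 0) :
    IsQuantumMatrix q fun i j => s j.rev i.rev := by
  refine IsQuantumMatrix.of_exchange hq fun p j k y => ?_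
  have := exchange_inverse hl hr (h.exchange_sum hq) y.rev j.rev p.rev k.rev
  rw [sum_betaCoef_right q y.rev j.rev (fun b m => s m p.rev * s b k.rev),
    Finset.sum_comm' (t' := Finset.univ) (s' := fun _ => Finset.univ) (by simp),
    Finset.sum_comm, 
    sum_betaCoef_left q k.rev p.rev (fun i c => s j.rev c * s y.rev i)] at this
  simpa [Fin.rev_lt_rev, Fin.rev_inj] using this

end Inverse

end QuantumMatrix

/-! ### Inversions of words and permutations. -/

section Inversions

variable {α : Type*} [LinearOrder α]

/-- The number of inversions of a word. -/
def invCount {r : ℕ} (a : Fin r → α) : ℕ :=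
  (Finset.univ.filter fun p : Fin r × Fin r => p.1 < p.2 ∧ a p.2 < a p.1).card

theorem invCount_succ {r : ℕ} (a : Fin (r + 1) → α) :
    invCount a = (Finset.univ.filter fun k : Fin r => a k.succ < a 0).card
      + invCount fun k => a k.succ := by
  simp only [invCount, Finset.card_filter, Fintype.sum_prod_type, Fin.sum_univ_succ,
    Fin.succ_pos, Fin.succ_lt_succ_iff, false_and, if_false, zero_add, true_and,
    Fin.not_lt_zero]

theorem invCount_comp_perm {r : ℕ} (b : Fin r ↪o α) (s : Equiv.Perm (Fin r)) :
    invCount (fun k => b (s k)) = permLength s := by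
  simp [invCount, permLength]

theorem permLength_symm {r : ℕ} (s : Equiv.Perm (Fin r)) : permLength s.symm = permLength s := by
  unfold permLength
  refine Finset.card_bij' (fun p _ => (s.symm p.2, s.symm p.1)) (fun p _ => (s p.2, s p.1))
    ?_ ?_ ?_ ?_ <;> simp +contextual

end Inversions

/-! ### Sorting words in a quantum exterior algebra. -/

section Exterior

variable {n : ℕ} {A B : Type*} [Ring A] [Algebra ℂ A] [Ring B] [Algebra ℂ B]

/-- The relations of the generators of a quantum exterior algebra. -/
structure IsExterior (q : ℂ) (e : Fin n → B) : Prop where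
  sq : ∀ i, e i * e i = 0
  swap : ∀ i j, i < j → e j * e i = (-q) • (e i * e j)

theorem sum_sum_eq_sum_lt {M : Type*} [AddCommMonoid M] (F : Fin n → Fin n → M)
    (hF : ∀ i, F i i = 0) :
    ∑ i, ∑ j, F i j = ∑ i, ∑ j, if i < j then F i j + F j i else 0 := by
  have h1 : ∀ i j, F i j = (if i < j then F i j else 0) + (if j < i then F i j else 0) := by
    intro i j
    rcases lt_trichotomy i j with h | rfl | h
    · simp [h, h.not_gt]
    · simp [hF]
    · simp [h, h.not_gt]
  have h2 : ∀ i j, (if i < j then F i j + F j i else 0)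
      = (if i < j then F i j else 0) + (if i < j then F j i else 0) := by
    intro i j; split_ifs <;> simp
  simp_rw [h2, Finset.sum_add_distrib]
  conv_lhs => enter [2, i, 2, j]; rw [h1 i j]
  simp_rw [Finset.sum_add_distrib]
  congr 1
  exact Finset.sum_comm

/-- Covariance of the exterior relations, from which both coactions arise. It is stated for any
quantum matrix so that it serves `t` and, with reversed indices, `tStar`. -/
theorem IsExterior.tensor {q : ℂ} (hq : q ≠ 0) {e : Fin n → B} (he : IsExterior q e)
    {x : Fin n → Fin n → A} (hx : IsQuantumMatrix q x) :
    IsExterior q fun j => ∑ i, e i ⊗ₜ[ℂ] x i j := by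
  -- Squares vanish and `e b * e a` is a multiple of `e a * e b`, so only pairs `a < b` remain, with
  -- quantum 2×2 minors as coefficients.
  have key : ∀ i j, (∑ a, e a ⊗ₜ[ℂ] x a i) * (∑ b, e b ⊗ₜ[ℂ] x b j) =
      ∑ a, ∑ b, if a < b then (e a * e b) ⊗ₜ[ℂ] (x a i * x b j - q • (x b i * x a j)) else 0 := by
    intro i j
    simp_rw [Finset.sum_mul_sum, Algebra.TensorProduct.tmul_mul_tmul]
    rw [sum_sum_eq_sum_lt]
    · refine Finset.sum_congr rfl fun a _ => Finset.sum_congr rfl fun b _ => ?_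
      split_ifs with h
      · rw [he.swap a b h, TensorProduct.smul_tmul, ← TensorProduct.tmul_add]
        congr 1; module
      · rfl
    · intro a; rw [he.sq, TensorProduct.zero_tmul]
  constructor
  · intro i
    rw [key]
    refine Finset.sum_eq_zero fun a _ => Finset.sum_eq_zero fun b _ => ?_
    split_ifs with h
    · rw [hx.col i a b h, sub_self, TensorProduct.tmul_zero]
    · rfl
  · intro i j hij
    rw [key, key, Finset.smul_sum]
    refine Finset.sum_congr rfl fun a _ => ?_
    rw [Finset.smul_sum]
    refine Finset.sum_congr rfl fun b _ => ?_
    split_ifs with h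
    · rw [← TensorProduct.tmul_smul]
      congr 1
      rw [hx.cross a b i j h hij, hx.comm a b i j h hij]
      match_scalars <;> field_simp
      ring
    · simp

variable {q : ℂ} {e : Fin n → B}

/-- The letter is moved to the right, up to scalars, until it meets its double. -/
theorem IsExterior.mul_prod_eq_zero (he : IsExterior q e) (hq : q ≠ 0) {x : Fin n}
    {l : List (Fin n)} (hx : x ∈ l) : e x * (l.map e).prod = 0 := by
  induction l with
  | nil => simp at hx
  | cons y l ih =>
    rw [List.map_cons, List.prod_cons, ← mul_assoc]
    rcases lt_trichotomy x y with h | rfl | h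
    · have hxl : x ∈ l := by simpa [h.ne] using hx
      have : e x * e y = (-q)⁻¹ • (e y * e x) := by
        rw [he.swap x y h, smul_smul, inv_mul_cancel₀ (neg_ne_zero.mpr hq), one_smul]
      rw [this, smul_mul_assoc, mul_assoc, ih hxl, mul_zero, smul_zero]
    · rw [he.sq, zero_mul]
    · have hxl : x ∈ l := by simpa [h.ne'] using hx
      rw [he.swap y x h, smul_mul_assoc, mul_assoc, ih hxl, mul_zero, smul_zero]

theorem IsExterior.prod_eq_zero (he : IsExterior q e) (hq : q ≠ 0)
    {l : List (Fin n)} (hl : ¬ l.Nodup) : (l.map e).prod = 0 := by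
  induction l with
  | nil => simp at hl
  | cons y l ih =>
    rw [List.map_cons, List.prod_cons]
    by_cases hy : y ∈ l
    · exact he.mul_prod_eq_zero hq hy
    · rw [ih (by simpa [List.nodup_cons, hy] using hl), mul_zero]

theorem IsExterior.word_eq_zero (he : IsExterior q e) (hq : q ≠ 0) {r : ℕ} {a : Fin r → Fin n}
    (ha : ¬ Function.Injective a) : (List.ofFn fun k => e (a k)).prod = 0 := by
  have : (List.ofFn fun k => e (a k)) = (List.ofFn a).map e := by
    simp [List.map_ofFn, Function.comp_def]
  rw [this]
  exact he.prod_eq_zero hq (by rwa [List.nodup_ofFn])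

/-- On its way to its sorted position the letter passes exactly the smaller letters, each at the
cost of a factor `-q`. -/
theorem IsExterior.mul_prod (he : IsExterior q e) {x : Fin n} {l : List (Fin n)}
    (hl : l.Pairwise (· ≤ ·)) (hx : x ∉ l) :
    e x * (l.map e).prod
      = (-q) ^ (l.countP (· < x)) • ((l.orderedInsert (· ≤ ·) x).map e).prod := by
  induction l with
  | nil => simp
  | cons y l ih =>
    rw [List.pairwise_cons] at hl
    rw [List.mem_cons, not_or] at hx
    rw [List.orderedInsert]
    rcases lt_or_gt_of_ne hx.1 with h | h
    · rw [if_pos h.le, List.countP_eq_zero.mpr, pow_zero, one_smul, List.map_cons (a := x),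
        List.prod_cons]
      intro z hz
      rcases List.mem_cons.mp hz with rfl | hz
      · simpa using h.le
      · simpa using h.le.trans (hl.1 z hz)
    · rw [if_neg h.not_ge, List.countP_cons_of_pos (by simpa using h), List.map_cons,
        List.prod_cons, ← mul_assoc, he.swap y x h, smul_mul_assoc, mul_assoc, ih hl.2 hx.2,
        List.map_cons, List.prod_cons, mul_smul_comm, smul_smul, pow_succ']

theorem IsExterior.prod_mul (he : IsExterior q e) {x : Fin n} {l : List (Fin n)}
    (hl : l.Pairwise (· ≤ ·)) (hx : x ∉ l) :
    (l.map e).prod * e x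
      = (-q) ^ (l.countP (x < ·)) • ((l.orderedInsert (· ≤ ·) x).map e).prod := by
  induction l with
  | nil => simp
  | cons y l ih =>
    rw [List.pairwise_cons] at hl
    rw [List.mem_cons, not_or] at hx
    rw [List.orderedInsert, List.map_cons, List.prod_cons, mul_assoc, ih hl.2 hx.2, mul_smul_comm]
    rcases lt_or_gt_of_ne hx.1 with h | h
    · rw [if_pos h.le, List.countP_cons_of_pos (by simpa using h)]
      have : l.orderedInsert (· ≤ ·) x = x :: l := by
        cases l with
        | nil => rfl
        | cons z l => rw [List.orderedInsert, if_pos (h.le.trans (hl.1 z (by simp)))]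
      rw [this]
      simp only [List.map_cons, List.prod_cons]
      rw [← mul_assoc, he.swap x y h, smul_mul_assoc, smul_smul, pow_succ, mul_assoc]
    · rw [if_neg h.not_ge, List.countP_cons_of_neg (by simpa using h.le), List.map_cons,
        List.prod_cons]

/-- The product of the `e i`, `i ∈ I`, in increasing order. -/
def extProd {B : Type*} [Monoid B] (e : Fin n → B) (I : Finset (Fin n)) : B :=
  ((I.sort (· ≤ ·)).map e).prod

theorem orderedInsert_sort {I : Finset (Fin n)} {x : Fin n} (hx : x ∉ I) :
    (I.sort (· ≤ ·)).orderedInsert (· ≤ ·) x = (insert x I).sort (· ≤ ·) := by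
  refine List.Perm.eq_of_pairwise' (r := (· ≤ ·)) ?_ ?_ ?_
  · exact List.Pairwise.orderedInsert _ _ (Finset.pairwise_sort I (· ≤ ·))
  · exact Finset.pairwise_sort _ (· ≤ ·)
  · refine (List.perm_orderedInsert _ _ _).trans ?_
    rw [← Multiset.coe_eq_coe, ← Multiset.cons_coe, Finset.sort_eq, Finset.sort_eq,
      Finset.insert_val_of_notMem hx]

theorem countP_sort (I : Finset (Fin n)) (p : Fin n → Prop) [DecidablePred p] :
    (I.sort (· ≤ ·)).countP (fun i => decide (p i)) = (I.filter p).card := by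
  rw [← Multiset.coe_countP, Finset.sort_eq, Multiset.countP_eq_card_filter]
  rfl

theorem IsExterior.mul_extProd (he : IsExterior q e) {I : Finset (Fin n)} {x : Fin n}
    (hx : x ∉ I) :
    e x * extProd e I = (-q) ^ (I.filter (· < x)).card • extProd e (insert x I) := by
  unfold extProd
  rw [he.mul_prod (Finset.pairwise_sort I (· ≤ ·)) (by simpa using hx), orderedInsert_sort hx,
    countP_sort]

theorem IsExterior.extProd_mul (he : IsExterior q e) {I : Finset (Fin n)} {x : Fin n}
    (hx : x ∉ I) :
    extProd e I * e x = (-q) ^ (I.filter (x < ·)).card • extProd e (insert x I) := by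
  unfold extProd
  rw [he.prod_mul (Finset.pairwise_sort I (· ≤ ·)) (by simpa using hx), orderedInsert_sort hx,
    countP_sort]

theorem IsExterior.mul_extProd_of_mem (he : IsExterior q e) (hq : q ≠ 0) {I : Finset (Fin n)}
    {x : Fin n} (hx : x ∈ I) : e x * extProd e I = 0 :=
  he.mul_prod_eq_zero hq (by simpa using hx)

theorem IsExterior.extProd_mul_of_mem (he : IsExterior q e) (hq : q ≠ 0) {I : Finset (Fin n)}
    {x : Fin n} (hx : x ∈ I) : extProd e I * e x = 0 := by
  have := he.prod_eq_zero hq (l := I.sort (· ≤ ·) ++ [x]) (by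
    rw [List.nodup_append]
    simp [hx])
  simpa [extProd] using this

/-- Sorting costs `-q` per inversion: the tail is sorted first, then the first letter is inserted,
and its inversions are the smaller letters after it. -/
theorem IsExterior.word_eq (he : IsExterior q e) {r : ℕ} {a : Fin r → Fin n}
    (ha : Function.Injective a) :
    (List.ofFn fun k => e (a k)).prod
      = (-q) ^ invCount a • extProd e (Finset.univ.image a) := by
  induction r with
  | zero => simp [invCount, extProd]
  | succ r ih =>
    have ha' : Function.Injective fun k : Fin r => a k.succ := ha.comp (Fin.succ_injective r)
    have h0 : a 0 ∉ Finset.univ.image fun k : Fin r => a k.succ := by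
      simp only [Finset.mem_image, Finset.mem_univ, true_and, not_exists]
      intro k hk
      exact absurd (ha hk) (Fin.succ_ne_zero k)
    rw [List.ofFn_succ, List.prod_cons, ih ha', mul_smul_comm, he.mul_extProd h0, smul_smul,
      invCount_succ, ← pow_add, add_comm]
    congr 3
    · rw [Finset.filter_image, Finset.card_image_of_injective _ ha']
    · ext i
      simp [Fin.exists_fin_succ, eq_comm]

theorem word_tensor (e : Fin n → B) (x : Fin n → Fin n → A) {r : ℕ} (b : Fin r → Fin n) :
    (List.ofFn fun k => ∑ i, e i ⊗ₜ[ℂ] x i (b k)).prod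
      = ∑ a : Fin r → Fin n, (List.ofFn fun k => e (a k)).prod ⊗ₜ[ℂ]
          (List.ofFn fun k => x (a k) (b k)).prod := by
  induction r with
  | zero => simp [Algebra.TensorProduct.one_def]
  | succ r ih =>
    rw [List.ofFn_succ, List.prod_cons, ih, ← (Fin.consEquiv fun _ => Fin n).sum_comp,
      Fintype.sum_prod_type, Finset.sum_mul]
    refine Finset.sum_congr rfl fun i _ => ?_
    rw [Finset.mul_sum]
    refine Finset.sum_congr rfl fun a _ => ?_
    simp [List.ofFn_succ, Fin.consEquiv]

/-- An injective word of length `m` with letters in the `m`-element range of `b` is a rearrangement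
of `b`. -/
theorem sum_eq_sum_perm {M : Type*} [AddCommMonoid M] {m : ℕ} (b : Fin m ↪o Fin n)
    (g : (Fin m → Fin n) → M)
    (hg : ∀ a, g a ≠ 0 → Function.Injective a ∧ ∀ k, a k ∈ Set.range b) :
    ∑ a, g a = ∑ s : Equiv.Perm (Fin m), g fun k => b (s k) := by
  symm
  refine Finset.sum_of_injOn (fun s k => b (s k)) ?_ (by simp) ?_ (by simp)
  · intro s _ s' _ h
    ext k
    exact congrArg Fin.val (b.injective (congrFun h k))
  · intro a _ ha
    by_contra hne
    obtain ⟨hinj, hr⟩ := hg a hne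
    choose f hf using hr
    have hfi : Function.Injective f := fun k k' h => hinj (by rw [← hf, ← hf, h])
    exact ha ⟨Equiv.ofBijective f (Finite.injective_iff_bijective.mp hfi), by simp,
      funext fun k => by simp [hf]⟩

end Exterior

/-! ### The algebras `Λ_q(V)` and `Λ_q(V^*)`; nonvanishing of the top degree. -/

section ExteriorAlgebras

variable {n : ℕ} {q : ℝ}

theorem isExterior_lv (hq : q ≠ 0) : IsExterior (q : ℂ) (lv q : Fin n → L n q) := by
  have hq' : (q : ℂ) ≠ 0 := by exact_mod_cast hq
  constructor
  · intro i
    have := RingQuot.mkAlgHom_rel ℂ (LRel.sq (n := n) (q := q) i)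
    simpa [lv] using this
  · intro i j h
    have := RingQuot.mkAlgHom_rel ℂ (LRel.swap (q := q) i j h)
    simp only [map_mul, map_smul] at this
    simp only [lv]
    rw [this, smul_smul, neg_mul_neg, mul_inv_cancel₀ hq', one_smul]

/-- The relations of `Λ_q(V^*)` are those of `Λ_q(V)` for the opposite order of the indices, so
reindexing by `Fin.rev` brings both under `IsExterior`. -/
theorem isExterior_ldv (hq : q ≠ 0) :
    IsExterior (q : ℂ) (fun i => ldv q i.rev : Fin n → Ld n q) := by
  have hq' : (q : ℂ) ≠ 0 := by exact_mod_cast hq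
  constructor
  · intro i
    have := RingQuot.mkAlgHom_rel ℂ (LdRel.sq (n := n) (q := q) i.rev)
    simpa [ldv] using this
  · intro i j h
    have := RingQuot.mkAlgHom_rel ℂ (LdRel.swap (q := q) j.rev i.rev (Fin.rev_lt_rev.mpr h))
    simp only [map_mul, map_smul] at this
    simp only [ldv]
    rw [this, smul_smul, neg_mul_neg, mul_inv_cancel₀ hq', one_smul]

variable {B : Type*} [Ring B] [Algebra ℂ B]

theorem IsExterior.exists_lift (hq : q ≠ 0) {e : Fin n → B} (he : IsExterior (q : ℂ) e) :
    ∃ f : L n q →ₐ[ℂ] B, ∀ i, f (lv q i) = e i := by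
  have hq' : (q : ℂ) ≠ 0 := by exact_mod_cast hq
  refine ⟨RingQuot.liftAlgHom ℂ ⟨FreeAlgebra.lift ℂ e, ?_⟩, fun i => ?_⟩
  rotate_left
  · rw [lv, RingQuot.liftAlgHom_mkAlgHom_apply, FreeAlgebra.lift_ι_apply]
  intro x y h
  cases h with
  | sq i => simp [he.sq]
  | swap i j h =>
    simp only [map_mul, map_smul, FreeAlgebra.lift_ι_apply]
    rw [he.swap i j h, smul_smul, neg_mul_neg, inv_mul_cancel₀ hq', one_smul]

theorem IsExterior.exists_lift_dual (hq : q ≠ 0) {e : Fin n → B}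
    (he : IsExterior (q : ℂ) fun i => e i.rev) :
    ∃ f : Ld n q →ₐ[ℂ] B, ∀ i, f (ldv q i) = e i := by
  have hq' : (q : ℂ) ≠ 0 := by exact_mod_cast hq
  refine ⟨RingQuot.liftAlgHom ℂ ⟨FreeAlgebra.lift ℂ e, ?_⟩, fun i => ?_⟩
  rotate_left
  · rw [ldv, RingQuot.liftAlgHom_mkAlgHom_apply, FreeAlgebra.lift_ι_apply]
  intro x y h
  cases h with
  | sq i => simpa using he.sq i.rev
  | swap i j h =>
    have := he.swap j.rev i.rev (Fin.rev_lt_rev.mpr h)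
    simp only [Fin.rev_rev] at this
    simp only [map_mul, map_smul, FreeAlgebra.lift_ι_apply]
    rw [this, smul_smul, neg_mul_neg, inv_mul_cancel₀ hq', one_smul]

/-- Left multiplication by `v_i` on the space spanned by the symbols `v_I`. -/
noncomputable def wedgeOp (q : ℂ) (i : Fin n) : Module.End ℂ (Finset (Fin n) →₀ ℂ) :=
  Finsupp.linearCombination ℂ fun I =>
    if i ∈ I then 0 else Finsupp.single (insert i I) ((-q) ^ (I.filter (· < i)).card)

theorem wedgeOp_single (q : ℂ) (i : Fin n) (I : Finset (Fin n)) (c : ℂ) :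
    wedgeOp q i (Finsupp.single I c) =
      if i ∈ I then 0 else Finsupp.single (insert i I) (c * (-q) ^ (I.filter (· < i)).card) := by
  simp only [wedgeOp, Finsupp.linearCombination_single]
  split_ifs <;> simp

/-- These operators represent `Λ_q(V)` on a space with known basis, which is how the top product is
seen not to be killed by the relations. -/
theorem isExterior_wedgeOp (q : ℂ) : IsExterior q (wedgeOp q : Fin n → _) := by
  constructor
  · intro i
    ext I : 2
    simp only [Module.End.mul_apply, LinearMap.comp_apply, Finsupp.lsingle_apply, wedgeOp_single]
    split_ifs <;> simp [wedgeOp_single]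
  · intro i j hij
    refine Finsupp.lhom_ext fun I c => ?_
    rw [LinearMap.smul_apply, Module.End.mul_apply, Module.End.mul_apply, wedgeOp_single,
      wedgeOp_single]
    by_cases hi : i ∈ I
    · by_cases hj : j ∈ I <;> simp only [hi, hj, if_true, if_false, map_zero, wedgeOp_single,
        Finset.mem_insert, or_true, smul_zero]
    · by_cases hj : j ∈ I
      · simp only [hi, hj, if_true, if_false, map_zero, wedgeOp_single,
          Finset.mem_insert, or_true, smul_zero]
      · simp only [hi, hj, if_false, wedgeOp_single, Finset.mem_insert, hij.ne', hij.ne, false_or,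
          Finsupp.smul_single]
        rw [Finset.insert_comm, Finset.filter_insert, if_pos hij, Finset.filter_insert,
          if_neg hij.not_gt, Finset.card_insert_of_notMem (by simp [hi])]
        congr 1
        rw [smul_eq_mul]; ring

theorem prod_wedgeOp {q : ℂ} (hq : q ≠ 0) {l : List (Fin n)} (hl : l.Nodup) :
    ∃ c : ℂ, c ≠ 0 ∧
      (l.map (wedgeOp q)).prod (Finsupp.single ∅ 1) = Finsupp.single l.toFinset c := by
  induction l with
  | nil => exact ⟨1, one_ne_zero, by simp⟩
  | cons x l ih =>
    rw [List.nodup_cons] at hl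
    obtain ⟨c, hc, h⟩ := ih hl.2
    refine ⟨c * (-q) ^ (l.toFinset.filter (· < x)).card,
      mul_ne_zero hc (pow_ne_zero _ (neg_ne_zero.mpr hq)), ?_⟩
    rw [List.map_cons, List.prod_cons, Module.End.mul_apply, h, wedgeOp_single]
    simp [hl.1]

theorem map_extProd {C D F : Type*} [Monoid C] [Monoid D] [FunLike F C D] [MonoidHomClass F C D]
    (f : F) (e : Fin n → C) (I : Finset (Fin n)) : f (extProd e I) = extProd (fun i => f (e i)) I := by
  simp [extProd, map_list_prod, Function.comp_def]

theorem exists_functional_top (hq : q ≠ 0) :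
    ∃ φ : L n q →ₗ[ℂ] ℂ, φ (extProd (lv q) Finset.univ) = 1 := by
  have hq' : (q : ℂ) ≠ 0 := by exact_mod_cast hq
  obtain ⟨f, hf⟩ := IsExterior.exists_lift hq (isExterior_wedgeOp (n := n) (q : ℂ))
  obtain ⟨c, hc, h⟩ := prod_wedgeOp hq' (Finset.sort_nodup (Finset.univ : Finset (Fin n)) (· ≤ ·))
  refine ⟨c⁻¹ • (Finsupp.lapply Finset.univ ∘ₗ LinearMap.applyₗ (Finsupp.single ∅ 1) ∘ₗ
    f.toLinearMap), ?_⟩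
  have hm := map_extProd f (lv q) Finset.univ
  simp only [hf] at hm
  rw [LinearMap.smul_apply, LinearMap.comp_apply, LinearMap.comp_apply, AlgHom.toLinearMap_apply,
    hm, LinearMap.applyₗ_apply_apply, extProd, h]
  simp [hc]

/-- Identities in `A` can therefore be proved as identities in `Λ_q(V) ⊗ A` in top degree. -/
theorem top_tmul_injective {A : Type*} [AddCommGroup A] [Module ℂ A] (hq : q ≠ 0) :
    Function.Injective fun a : A => extProd (lv q : Fin n → _) Finset.univ ⊗ₜ[ℂ] a := by
  obtain ⟨φ, hφ⟩ := exists_functional_top (n := n) hq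
  intro a b h
  have := congrArg (TensorProduct.lid ℂ A ∘ LinearMap.rTensor A φ) h
  simpa [hφ] using this

end ExteriorAlgebras

/-! ### Quantum Laplace expansions and transposed minors. -/

section Laplace

variable {q : ℝ} {A : Type*} [Ring A] [Algebra ℂ A]

theorem range_complEmb {n : ℕ} (i : Fin n) : Set.range (complEmb i) = {i}ᶜ := by
  simp [complEmb]

theorem permLength_one {r : ℕ} : permLength (1 : Equiv.Perm (Fin r)) = 0 := by
  rw [permLength, Finset.card_eq_zero, Finset.filter_eq_empty_iff]
  rintro p - ⟨h, h'⟩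
  exact lt_asymm h h'

theorem image_complEmb_perm {n : ℕ} (i : Fin n) (s : Equiv.Perm (Fin (n - 1))) :
    Finset.univ.image (fun k => complEmb i (s k)) = {i}ᶜ := by
  apply Finset.coe_injective
  rw [Finset.coe_image, Finset.coe_univ, Set.image_univ, Finset.coe_compl, Finset.coe_singleton,
    ← range_complEmb]
  exact s.surjective.range_comp _

theorem word_complEmb_perm {n : ℕ} {B : Type*} [Ring B] [Algebra ℂ B] {q : ℂ} {e : Fin n → B}
    (he : IsExterior q e) (i : Fin n) (s : Equiv.Perm (Fin (n - 1))) :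
    (List.ofFn fun k => e (complEmb i (s k))).prod = (-q) ^ permLength s • extProd e {i}ᶜ := by
  rw [he.word_eq (a := fun k => complEmb i (s k)) ((complEmb i).injective.comp s.injective),
    invCount_comp_perm, image_complEmb_perm]

/-- The transpose appears because here the columns stay in order while the rows are permuted. -/
theorem word_tensor_top {n : ℕ} (hq : q ≠ 0) (x : Fin n → Fin n → A) :
    extProd (fun j => ∑ i, lv q i ⊗ₜ[ℂ] x i j) Finset.univ
      = extProd (lv q) Finset.univ ⊗ₜ[ℂ] qDet q fun i j => x j i := by
  have hq' : (q : ℂ) ≠ 0 := by exact_mod_cast hq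
  have h1 : extProd (fun j => ∑ i, lv q i ⊗ₜ[ℂ] x i j) Finset.univ
      = (List.ofFn fun k => ∑ i, lv q i ⊗ₜ[ℂ] x i (k : Fin n)).prod := by
    have : (Finset.univ : Finset (Fin n)).sort (· ≤ ·) = List.finRange n := Fin.sort_univ n
    rw [extProd, this, List.ofFn_eq_map]
  rw [h1, word_tensor (lv q) x (fun k => k),
    sum_eq_sum_perm (OrderIso.refl (Fin n)).toOrderEmbedding, qDet, qMinor, TensorProduct.tmul_sum]
  · refine Finset.sum_congr rfl fun s _ => ?_
    rw [(isExterior_lv hq).word_eq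
      (a := fun k => (OrderIso.refl (Fin n)).toOrderEmbedding (s k))
      ((OrderIso.refl (Fin n)).toOrderEmbedding.injective.comp s.injective), invCount_comp_perm,
      TensorProduct.smul_tmul]
    congr 2
    exact Finset.image_univ_of_surjective s.surjective
  · intro a ha
    refine ⟨?_, fun k => by simp⟩
    by_contra hinj
    exact ha (by rw [(isExterior_lv hq).word_eq_zero hq' hinj, TensorProduct.zero_tmul])

/-- `F` will be multiplication by `v_j ⊗ x_{ji}` on one side. It kills the words containing `j`, so
of the words of length `n - 1` only the rearrangements of the complement of `j` count. -/
theorem map_sum_words_complEmb {n : ℕ} (hq : q ≠ 0) (x : Fin n → Fin n → A) (j : Fin n)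
    (c : Fin (n - 1) → Fin n) (F : L n q ⊗[ℂ] A →ₗ[ℂ] L n q ⊗[ℂ] A)
    (hF : ∀ a : Fin (n - 1) → Fin n, j ∈ Set.range a → ∀ y, F (lword q a ⊗ₜ y) = 0) :
    F (∑ a : Fin (n - 1) → Fin n, (List.ofFn fun k => lv q (a k)).prod ⊗ₜ[ℂ]
          (List.ofFn fun k => x (a k) (c k)).prod)
      = F (extProd (lv q) {j}ᶜ ⊗ₜ[ℂ] ∑ s : Equiv.Perm (Fin (n - 1)),
        (-(q : ℂ)) ^ permLength s • (List.ofFn fun k => x (complEmb j (s k)) (c k)).prod) := by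
  have hq' : (q : ℂ) ≠ 0 := by exact_mod_cast hq
  rw [map_sum, sum_eq_sum_perm (complEmb j), TensorProduct.tmul_sum, map_sum]
  · refine Finset.sum_congr rfl fun s _ => ?_
    rw [word_complEmb_perm (isExterior_lv hq), TensorProduct.smul_tmul]
  · intro a ha
    constructor
    · by_contra hinj
      exact ha (by rw [(isExterior_lv hq).word_eq_zero hq' hinj, TensorProduct.zero_tmul, map_zero])
    · intro k
      rw [range_complEmb, Set.mem_compl_iff, Set.mem_singleton_iff]
      intro hk
      exact ha (hF a ⟨k, hk⟩ _)

theorem card_compl_filter_lt {n : ℕ} (i : Fin n) :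
    (({i}ᶜ : Finset (Fin n)).filter (· < i)).card = i := by
  rw [← Fin.card_Iio]
  congr 1
  ext j
  simpa using fun h : j < i => h.ne

theorem card_compl_filter_gt {n : ℕ} (i : Fin n) :
    (({i}ᶜ : Finset (Fin n)).filter (i < ·)).card = n - 1 - i := by
  rw [← Fin.card_Ioi]
  congr 1
  ext j
  simpa using fun h : i < j => h.ne'

/-- The product of the coacted generator `i` with those of all indices other than `k` is computed
twice: by expanding in words (`h1`), and from the exterior relations of the coacted generators
(`h2`), which give `0` or a multiple of the top element. With indices from `0`, exactly `j` letters
are smaller than `j`, hence the power of `-q`. -/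
theorem laplace_left {n : ℕ} (hq : q ≠ 0) {x : Fin n → Fin n → A}
    (hx : IsQuantumMatrix (q : ℂ) x) (i k : Fin n) :
    ∑ j : Fin n, (-(q : ℂ)) ^ (j : ℕ) • (x j i * qMinor q (fun a b => x b a) (complEmb k) (complEmb j))
      = if i = k then (-(q : ℂ)) ^ (k : ℕ) • qDet q (fun a b => x b a) else 0 := by
  have hq' : (q : ℂ) ≠ 0 := by exact_mod_cast hq
  have hE := (isExterior_lv (n := n) hq).tensor hq' hx
  apply top_tmul_injective (n := n) hq
  have h1 : (∑ j, lv q j ⊗ₜ[ℂ] x j i) * (List.ofFn fun l => ∑ j, lv q j ⊗ₜ[ℂ] x j (complEmb k l)).prod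
      = extProd (lv q) Finset.univ ⊗ₜ[ℂ] ∑ j : Fin n, (-(q : ℂ)) ^ (j : ℕ) •
        (x j i * qMinor q (fun a b => x b a) (complEmb k) (complEmb j)) := by
    rw [word_tensor, Finset.sum_mul, TensorProduct.tmul_sum]
    refine Finset.sum_congr rfl fun j _ => ?_
    have := map_sum_words_complEmb hq x j (complEmb k) (LinearMap.mulLeft ℂ (lv q j ⊗ₜ[ℂ] x j i)) (by
      rintro a ⟨l, hl⟩ y
      rw [LinearMap.mulLeft_apply, Algebra.TensorProduct.tmul_mul_tmul]
      have : lv q j * lword q a = 0 := by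
        have := (isExterior_lv (n := n) hq).mul_prod_eq_zero hq' (x := j) (l := List.ofFn a)
          (by rw [List.mem_ofFn]; exact ⟨l, hl⟩)
        simpa [lword, List.map_ofFn, Function.comp_def] using this
      rw [this, TensorProduct.zero_tmul])
    rw [LinearMap.mulLeft_apply, LinearMap.mulLeft_apply] at this
    rw [this, Algebra.TensorProduct.tmul_mul_tmul, (isExterior_lv hq).mul_extProd (by simp),
      card_compl_filter_lt, TensorProduct.smul_tmul]
    congr 2
    simp
  have h2 := word_complEmb_perm hE k 1
  simp only [Equiv.Perm.coe_one, id_eq, permLength_one, pow_zero, one_smul] at h2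
  dsimp only
  rw [← h1, h2]
  split_ifs with hik
  · subst hik
    rw [hE.mul_extProd (by simp), card_compl_filter_lt]
    simp only [Finset.insert_compl_self]
    rw [word_tensor_top hq, TensorProduct.tmul_smul]
  · rw [hE.mul_extProd_of_mem hq' (by simpa using hik), TensorProduct.tmul_zero]

/-- The mirror image of `laplace_left`: a letter coming from the right passes the `n - 1 - j` larger
ones. -/
theorem laplace_right {n : ℕ} (hq : q ≠ 0) {x : Fin n → Fin n → A}
    (hx : IsQuantumMatrix (q : ℂ) x) (i k : Fin n) :
    ∑ j : Fin n, (-(q : ℂ)) ^ (n - 1 - j) •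
        (qMinor q (fun a b => x b a) (complEmb k) (complEmb j) * x j i)
      = if i = k then (-(q : ℂ)) ^ (n - 1 - k) • qDet q (fun a b => x b a) else 0 := by
  have hq' : (q : ℂ) ≠ 0 := by exact_mod_cast hq
  have hE := (isExterior_lv (n := n) hq).tensor hq' hx
  apply top_tmul_injective (n := n) hq
  have h1 : (List.ofFn fun l => ∑ j, lv q j ⊗ₜ[ℂ] x j (complEmb k l)).prod * (∑ j, lv q j ⊗ₜ[ℂ] x j i)
      = extProd (lv q) Finset.univ ⊗ₜ[ℂ] ∑ j : Fin n, (-(q : ℂ)) ^ (n - 1 - j) •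
        (qMinor q (fun a b => x b a) (complEmb k) (complEmb j) * x j i) := by
    rw [word_tensor, Finset.mul_sum, TensorProduct.tmul_sum]
    refine Finset.sum_congr rfl fun j _ => ?_
    have := map_sum_words_complEmb hq x j (complEmb k) (LinearMap.mulRight ℂ (lv q j ⊗ₜ[ℂ] x j i)) (by
      rintro a ⟨l, hl⟩ y
      rw [LinearMap.mulRight_apply, Algebra.TensorProduct.tmul_mul_tmul]
      have : lword q a * lv q j = 0 := by
        have := (isExterior_lv (n := n) hq).prod_eq_zero hq' (l := List.ofFn a ++ [j])
          (by rw [List.nodup_append]; simp; exact fun _ => ⟨l, hl⟩)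
        simpa [lword, List.map_ofFn, Function.comp_def] using this
      rw [this, TensorProduct.zero_tmul])
    rw [LinearMap.mulRight_apply, LinearMap.mulRight_apply] at this
    rw [this, Algebra.TensorProduct.tmul_mul_tmul, (isExterior_lv hq).extProd_mul (by simp),
      card_compl_filter_gt, TensorProduct.smul_tmul]
    congr 2
    simp
  have h2 := word_complEmb_perm hE k 1
  simp only [Equiv.Perm.coe_one, id_eq, permLength_one, pow_zero, one_smul] at h2
  dsimp only
  rw [← h1, h2]
  split_ifs with hik
  · subst hik
    rw [hE.extProd_mul (by simp), card_compl_filter_gt]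
    simp only [Finset.insert_compl_self]
    rw [word_tensor_top hq, TensorProduct.tmul_smul]
  · rw [hE.extProd_mul_of_mem hq' (by simpa using hik), TensorProduct.tmul_zero]

theorem prod_orderedInsert_of_commute {ι : Type*} {r : ι → ι → Prop} [DecidableRel r]
    {M : Type*} [Monoid M] (f : ι → M) (x : ι) (l : List ι)
    (h : ∀ y ∈ l, ¬ r x y → f x * f y = f y * f x) :
    ((l.orderedInsert r x).map f).prod = f x * (l.map f).prod := by
  induction l with
  | nil => simp
  | cons y l ih =>
    rw [List.orderedInsert]
    split_ifs with hr
    · simp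
    · rw [List.map_cons, List.prod_cons, ih fun z hz => h z (by simp [hz]), List.map_cons,
        List.prod_cons, ← mul_assoc, ← mul_assoc, h y (by simp) hr]

theorem prod_insertionSort_of_commute {ι : Type*} {r : ι → ι → Prop} [DecidableRel r]
    {M : Type*} [Monoid M] (f : ι → M) (l : List ι)
    (h : l.Pairwise fun x y => ¬ r x y → f x * f y = f y * f x) :
    ((l.insertionSort r).map f).prod = (l.map f).prod := by
  induction l with
  | nil => simp
  | cons x l ih =>
    rw [List.pairwise_cons] at h
    rw [List.insertionSort_cons, prod_orderedInsert_of_commute, ih h.2, List.map_cons,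
      List.prod_cons]
    intro y hy
    exact h.1 y ((List.perm_insertionSort r l).mem_iff.mp hy)

/-- Factors whose rows are out of order while their columns increase stand in antidiagonal position
and commute, so the product can be sorted by rows for free. -/
theorem IsQuantumMatrix.prod_reorder {n r : ℕ} {q : ℂ} {x : Fin n → Fin n → A}
    (hx : IsQuantumMatrix q x) (a b : Fin r ↪o Fin n) (s : Equiv.Perm (Fin r)) :
    (List.ofFn fun k => x (a (s k)) (b k)).prod
      = (List.ofFn fun k => x (a k) (b (s.symm k))).prod := by
  let f : Fin r × Fin r → A := fun p => x (a p.1) (b p.2)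
  let R : Fin r × Fin r → Fin r × Fin r → Prop := fun p p' => p.1 ≤ p'.1
  have h := prod_insertionSort_of_commute (r := R) f (List.ofFn fun k => (s k, k)) (by
    rw [List.pairwise_ofFn]
    intro k k' hk hR
    exact (hx.comm _ _ _ _ (a.strictMono (not_le.mp hR)) (b.strictMono hk)).symm)
  have h2 : (List.ofFn fun k => (s k, k)).insertionSort R
      = List.ofFn fun k => (k, s.symm k) := by
    -- `R` compares rows only; it is antisymmetric on these entries because the row `s k` determines
    -- the pair.
    refine List.Perm.eq_of_pairwise (le := R) ?_ (List.pairwise_insertionSort R _) ?_ ?_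
    · intro p p' hp hp' h1 h2
      rw [(List.perm_insertionSort R _).mem_iff, List.mem_ofFn] at hp
      rw [List.mem_ofFn] at hp'
      obtain ⟨k, rfl⟩ := hp
      obtain ⟨k', rfl⟩ := hp'
      have : s k = k' := le_antisymm h1 h2
      simp [← this]
    · rw [List.pairwise_ofFn]
      exact fun _ _ h => h.le
    · refine (List.perm_insertionSort R _).trans ?_
      have := Equiv.Perm.ofFn_comp_perm s fun k => (k, s.symm k)
      simpa [Function.comp_def] using this
  rw [h2] at h
  simpa [List.map_ofFn, Function.comp_def, f] using h.symm

theorem IsQuantumMatrix.qMinor_transpose {n r : ℕ} {x : Fin n → Fin n → A}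
    (hx : IsQuantumMatrix (q : ℂ) x) (a b : Fin r ↪o Fin n) :
    qMinor q (fun i j => x j i) b a = qMinor q x a b := by
  unfold qMinor
  rw [← Equiv.sum_comp (Equiv.inv (Equiv.Perm (Fin r)))]
  refine Finset.sum_congr rfl fun s _ => ?_
  rw [Equiv.inv_apply, hx.prod_reorder]
  congr 2
  exact permLength_symm s

end Laplace

/-! ### The antipode inverts the generating matrix; existence of the coactions. -/

section Antipode

variable {n : ℕ} {q : ℝ}

theorem isQuantumMatrix_t : IsQuantumMatrix (q : ℂ) (t q : Fin n → Fin n → Aq n q) where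
  row k i j h := by
    have := RingQuot.mkAlgHom_rel ℂ (AqRel.row (q := q) k i j h)
    rw [map_smul, map_mul, map_mul] at this
    exact this
  col k i j h := by
    have := RingQuot.mkAlgHom_rel ℂ (AqRel.col (q := q) k i j h)
    rw [map_smul, map_mul, map_mul] at this
    exact this
  comm i k j m h h' := by
    simpa [t] using RingQuot.mkAlgHom_rel ℂ (AqRel.comm (q := q) i k j m h h')
  cross i k j m h h' := by
    have := RingQuot.mkAlgHom_rel ℂ (AqRel.cross (q := q) i k j m h h')
    rw [map_sub, sub_eq_iff_eq_add, map_smul, map_mul, map_mul, map_mul, add_comm] at this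
    exact this

theorem qDet_mul_detInv : qDet q (t q) * detInv n q = 1 := by
  have := RingQuot.mkAlgHom_rel ℂ (AqRel.det_mul_d (n := n) (q := q))
  rw [map_mul, map_qDet, map_one] at this
  exact this

theorem detInv_mul_qDet : detInv n q * qDet q (t q) = 1 := by
  have := RingQuot.mkAlgHom_rel ℂ (AqRel.d_mul_det (n := n) (q := q))
  rw [map_mul, map_qDet, map_one] at this
  exact this

theorem sum_t_mul_qMinor (hq : q ≠ 0) (i k : Fin n) :
    ∑ j : Fin n, (-(q : ℂ)) ^ ((j : ℤ) - (k : ℤ)) •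
      (t q i j * qMinor q (t q) (complEmb k) (complEmb j))
      = if i = k then qDet q (t q) else 0 := by
  have hq' : (-(q : ℂ)) ≠ 0 := neg_ne_zero.mpr (by exact_mod_cast hq)
  have h := laplace_left hq (isQuantumMatrix_t (n := n) (q := q)).transpose i k
  have h2 := congrArg (fun y => (-(q : ℂ)) ^ (-(k : ℤ)) • y) h
  simp only [Finset.smul_sum, smul_smul, smul_ite, smul_zero] at h2
  simp_rw [← zpow_natCast, ← zpow_add₀ hq'] at h2
  simpa [sub_eq_neg_add] using h2

theorem sum_qMinor_mul_t (hq : q ≠ 0) (i k : Fin n) :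
    ∑ j : Fin n, (-(q : ℂ)) ^ ((i : ℤ) - (j : ℤ)) •
      (qMinor q (t q) (complEmb j) (complEmb i) * t q j k)
      = if i = k then qDet q (t q) else 0 := by
  have hq' : (-(q : ℂ)) ≠ 0 := neg_ne_zero.mpr (by exact_mod_cast hq)
  have h := laplace_right hq (isQuantumMatrix_t (n := n) (q := q)) k i
  -- This factor turns the exponent `n - 1 - j` of the expansion into the exponent `i - j` of the
  -- antipode.
  have h2 := congrArg (fun y => (-(q : ℂ)) ^ ((i : ℤ) - (n - 1 : ℕ)) • y) h
  simp only [Finset.smul_sum, smul_smul, smul_ite, smul_zero] at h2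
  have hj : ∀ j : Fin n, ((n - 1 - j : ℕ) : ℤ) = (n - 1 : ℕ) - (j : ℤ) := fun j => by omega
  simp_rw [← zpow_natCast, ← zpow_add₀ hq', hj, isQuantumMatrix_t.qMinor_transpose] at h2
  have hD : qDet q (fun a b => t q b a) = qDet q (t q : Fin n → Fin n → Aq n q) :=
    isQuantumMatrix_t.qMinor_transpose _ _
  rw [hD] at h2
  simpa [eq_comm] using h2

/-- The matrix of signed minors is an adjugate on both sides, so associativity of `t · adj · t`
makes the determinant commute with every entry. -/
theorem qDet_comm_t (hq : q ≠ 0) (i j : Fin n) : qDet q (t q) * t q i j = t q i j * qDet q (t q) := by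
  have h1 : qDet q (t q) * t q i j = ∑ k : Fin n, (∑ m : Fin n, (-(q : ℂ)) ^ ((m : ℤ) - (k : ℤ)) •
      (t q i m * qMinor q (t q) (complEmb k) (complEmb m))) * t q k j := by
    simp_rw [sum_t_mul_qMinor hq]; simp
  have h2 : t q i j * qDet q (t q) = ∑ m : Fin n, t q i m * (∑ k : Fin n, (-(q : ℂ)) ^ ((m : ℤ) - (k : ℤ)) •
      (qMinor q (t q) (complEmb k) (complEmb m) * t q k j)) := by
    simp_rw [sum_qMinor_mul_t hq]; simp
  rw [h1, h2]
  simp_rw [Finset.sum_mul, Finset.mul_sum, smul_mul_assoc, mul_smul_comm, mul_assoc]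
  exact Finset.sum_comm

theorem detInv_comm_t (hq : q ≠ 0) (i j : Fin n) : detInv n q * t q i j = t q i j * detInv n q :=
  calc detInv n q * t q i j
      = detInv n q * (t q i j * qDet q (t q)) * detInv n q := by
        rw [mul_assoc, mul_assoc, qDet_mul_detInv, mul_one]
    _ = t q i j * detInv n q := by
        rw [← qDet_comm_t hq, ← mul_assoc, detInv_mul_qDet, one_mul]

theorem sum_t_mul_antipodeT (hq : q ≠ 0) (i k : Fin n) :
    ∑ j, t q i j * antipodeT q j k = if i = k then 1 else 0 := by
  have h := congrArg (· * detInv n q) (sum_t_mul_qMinor hq i k)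
  simp only [Finset.sum_mul, smul_mul_assoc, mul_assoc, ite_mul, zero_mul, qDet_mul_detInv] at h
  simpa only [antipodeT, mul_smul_comm] using h

theorem sum_antipodeT_mul_t (hq : q ≠ 0) (i k : Fin n) :
    ∑ j, antipodeT q i j * t q j k = if i = k then 1 else 0 := by
  have h := congrArg (· * detInv n q) (sum_qMinor_mul_t hq i k)
  simp only [Finset.sum_mul, smul_mul_assoc, mul_assoc, ite_mul, zero_mul, qDet_mul_detInv] at h
  simpa only [antipodeT, smul_mul_assoc, mul_assoc, detInv_comm_t hq] using h

theorem isQuantumMatrix_tStar (hq : q ≠ 0) :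
    IsQuantumMatrix (q : ℂ) fun i j : Fin n => tStar q i.rev j.rev :=
  isQuantumMatrix_t.inverse (by exact_mod_cast hq) (sum_antipodeT_mul_t hq)
    (sum_t_mul_antipodeT hq)

theorem tStar_mul_t_exchange (hq : q ≠ 0) (i j k z : Fin n) :
    ∑ c, ∑ y, betaCoef (q : ℂ) i j c y • (t q k c * tStar q z y)
      = ∑ p, ∑ b, betaCoef (q : ℂ) p b k z • (tStar q p i * t q b j) :=
  exchange_mixed (sum_antipodeT_mul_t hq) (sum_t_mul_antipodeT hq)
    (isQuantumMatrix_t.exchange_sum (by exact_mod_cast hq)) i j k z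

theorem exists_coactionL (hq : q ≠ 0) :
    ∃ ρ : L n q →ₐ[ℂ] L n q ⊗[ℂ] Aq n q, IsCoactionL ρ :=
  IsExterior.exists_lift hq ((isExterior_lv hq).tensor (by exact_mod_cast hq) isQuantumMatrix_t)

theorem exists_coactionLd (hq : q ≠ 0) :
    ∃ ρ : Ld n q →ₐ[ℂ] Ld n q ⊗[ℂ] Aq n q, IsCoactionLd ρ := by
  refine IsExterior.exists_lift_dual (e := fun j => ∑ i, ldv q i ⊗ₜ[ℂ] tStar q i j) hq ?_
  have := (isExterior_ldv hq).tensor (by exact_mod_cast hq) (isQuantumMatrix_tStar (n := n) hq)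
  convert this using 2 with j
  exact (Equiv.sum_comp Fin.revPerm fun i => ldv q i ⊗ₜ[ℂ] tStar q i j.rev).symm

theorem res_t (i j : Fin n) : res n q (t q i j) = if i = j then zPow (Pi.single i 1) else 0 := by
  rw [res, t, RingQuot.liftAlgHom_mkAlgHom_apply, FreeAlgebra.lift_ι_apply]
  rfl

/-- On the torus `t` becomes diagonal and invertible, so its inverse is forced and no minor has to
be restricted. -/
theorem res_tStar (hq : q ≠ 0) (i j : Fin n) :
    res n q (tStar q i j) = if i = j then zPow (-Pi.single i 1) else 0 := by
  have h := congrArg (res n q) (sum_t_mul_antipodeT hq j i)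
  simp only [map_sum, map_mul, res_t, ite_mul, zero_mul, Finset.sum_ite_eq, Finset.mem_univ,
    if_true] at h
  have h2 := congrArg (zPow (-Pi.single j 1) * ·) h
  simp only [← mul_assoc, zPow_mul, neg_add_cancel] at h2
  have h0 : (zPow 0 : Torus n) = 1 := rfl
  rw [h0, one_mul] at h2
  rw [tStar, h2]
  by_cases hij : j = i
  · simp [hij]
  · simp [hij, Ne.symm hij]

end Antipode

/-! ### `Ψ̂_r` commutes with the coactions. -/

section Intertwiner

variable {n r : ℕ} {q : ℝ}

theorem matrixCoaction_basis {ι M : Type*} [Fintype ι] [AddCommMonoid M] [Module ℂ M]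
    (b : Module.Basis ι ℂ M) (x : ι → ι → Aq n q) (j : ι) :
    matrixCoaction b x (b j) = ∑ i, b i ⊗ₜ[ℂ] x i j := by
  rw [matrixCoaction, Module.Basis.constr_basis]

theorem IsIntertwiner.comp {M N P : Type*} [AddCommMonoid M] [Module ℂ M] [AddCommMonoid N]
    [Module ℂ N] [AddCommMonoid P] [Module ℂ P] {ρ₁ : M →ₗ[ℂ] M ⊗[ℂ] Aq n q}
    {ρ₂ : N →ₗ[ℂ] N ⊗[ℂ] Aq n q} {ρ₃ : P →ₗ[ℂ] P ⊗[ℂ] Aq n q} {f : M →ₗ[ℂ] N} {g : N →ₗ[ℂ] P}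
    (hg : IsIntertwiner ρ₂ ρ₃ g) (hf : IsIntertwiner ρ₁ ρ₂ f) : IsIntertwiner ρ₁ ρ₃ (g ∘ₗ f) := by
  unfold IsIntertwiner at *
  rw [← LinearMap.comp_assoc, hg, LinearMap.comp_assoc, hf, ← LinearMap.comp_assoc,
    LinearMap.rTensor_comp]

theorem IsIntertwiner.id {M : Type*} [AddCommMonoid M] [Module ℂ M]
    (ρ : M →ₗ[ℂ] M ⊗[ℂ] Aq n q) : IsIntertwiner ρ ρ (1 : Module.End ℂ M) := by
  unfold IsIntertwiner
  rw [Module.End.one_eq_id, LinearMap.rTensor_id, LinearMap.comp_id, LinearMap.id_comp]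

theorem repr_beta (i j k m : Fin n) :
    (bVVd n).repr (beta n q (bVd n i ⊗ₜ[ℂ] bV n j)) (k, m) = betaCoef (q : ℂ) i j k m := by
  have h : ∀ a b, bV n a ⊗ₜ[ℂ] bVd n b = bVVd n (a, b) := fun a b => by
    rw [bVVd, Module.Basis.tensorProduct_apply]
  have h' : bVd n i ⊗ₜ[ℂ] bV n j = (bVd n).tensorProduct (bV n) (i, j) := by
    rw [Module.Basis.tensorProduct_apply]
  rw [h', beta, Module.Basis.constr_basis]
  simp only [h, map_add, map_smul, map_sum, Module.Basis.repr_self, Finsupp.add_apply,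
    Finsupp.smul_apply, Finsupp.coe_finsetSum, Finset.sum_apply, smul_eq_mul, betaCoef]
  congr 1
  · rw [Finsupp.single_apply]
    simp [Prod.ext_iff, eq_comm]
  · by_cases hij : i = j
    · simp only [hij, if_true, true_and]
      by_cases hkm : k = m
      · subst hkm
        simp [Finsupp.single_apply, Finset.sum_ite_eq']
      · rw [Finset.sum_eq_zero]
        · simp [hkm]
        · intro a _
          rw [Finsupp.single_apply, if_neg]
          rintro ⟨⟩
          exact hkm rfl
    · simp [hij]

theorem betaAt_basis (i j : Fin r) (a b : Fin r → Fin n) :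
    betaAt n q i j (bMix n r (a, b)) = ∑ k, ∑ m, betaCoef (q : ℂ) (b i) (a j) k m •
      bMix n r (Function.update a j k, Function.update b i m) := by
  rw [betaAt, Module.Basis.constr_basis]
  simp only [repr_beta]

/-- The coefficient of the coaction on a factor `V_k` or `V_k^*`. -/
noncomputable def factorCoef (q : ℝ) (a' b' a b : Fin r → Fin n) : Fin r ⊕ Fin r → Aq n q
  | Sum.inl k => t q (a' k) (a k)
  | Sum.inr k => tStar q (b' k) (b k)

/-- The coaction on the tensor product of the factors `V_k`, `V_k^*` in the order given by `W`. -/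
noncomputable def wordCoaction (n : ℕ) (q : ℝ) {r : ℕ} (W : List (Fin r ⊕ Fin r)) :
    VPow n r ⊗[ℂ] VdPow n r →ₗ[ℂ] (VPow n r ⊗[ℂ] VdPow n r) ⊗[ℂ] Aq n q :=
  matrixCoaction (bMix n r) fun p' p => (W.map (factorCoef q p'.1 p'.2 p.1 p.2)).prod

/-- Exchanging the letter `a j` with `k` is an involution on pairs `(a, k)`. It turns a sum over
source basis vectors into one over target basis vectors. -/
theorem sum_update_comm {M : Type*} [AddCommMonoid M] (j : Fin r)
    (G : (Fin r → Fin n) → (Fin r → Fin n) → M) :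
    ∑ a, ∑ k, G a (Function.update a j k) = ∑ a, ∑ k, G (Function.update a j k) a := by
  rw [← Fintype.sum_prod_type', ← Fintype.sum_prod_type']
  let e : (Fin r → Fin n) × Fin n → (Fin r → Fin n) × Fin n :=
    fun p => (Function.update p.1 j p.2, p.1 j)
  have he : Function.Involutive e := fun p => by simp [e]
  rw [← Equiv.sum_comp he.toPerm]
  refine Finset.sum_congr rfl fun p _ => ?_
  simp [e]

theorem map_factorCoef_update_right {W : List (Fin r ⊕ Fin r)} {i j : Fin r}
    (hi : Sum.inr i ∉ W) (hj : Sum.inl j ∉ W) (a' b' a b : Fin r → Fin n) (c y : Fin n) :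
    W.map (factorCoef q a' b' (Function.update a j c) (Function.update b i y))
      = W.map (factorCoef q a' b' a b) := by
  refine List.map_congr_left fun x hx => ?_
  rcases x with k | k
  · have : k ≠ j := fun h => hj (h ▸ hx)
    simp [factorCoef, this]
  · have : k ≠ i := fun h => hi (h ▸ hx)
    simp [factorCoef, this]

theorem map_factorCoef_update_left {W : List (Fin r ⊕ Fin r)} {i j : Fin r}
    (hi : Sum.inr i ∉ W) (hj : Sum.inl j ∉ W) (a' b' a b : Fin r → Fin n) (c y : Fin n) :
    W.map (factorCoef q (Function.update a' j c) (Function.update b' i y) a b)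
      = W.map (factorCoef q a' b' a b) := by
  refine List.map_congr_left fun x hx => ?_
  rcases x with k | k
  · have : k ≠ j := fun h => hj (h ▸ hx)
    simp [factorCoef, this]
  · have : k ≠ i := fun h => hi (h ▸ hx)
    simp [factorCoef, this]

/-- Since no factor is repeated, `W₁` and `W₂` do not see the updated indices, and comparing
coefficients reduces to `tStar_mul_t_exchange` placed between two fixed products. -/
theorem betaAt_intertwiner (hq : q ≠ 0) {W₁ W₂ : List (Fin r ⊕ Fin r)} {i j : Fin r}
    (hW : (W₁ ++ Sum.inr i :: Sum.inl j :: W₂).Nodup) :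
    IsIntertwiner (wordCoaction n q (W₁ ++ Sum.inr i :: Sum.inl j :: W₂))
      (wordCoaction n q (W₁ ++ Sum.inl j :: Sum.inr i :: W₂)) (betaAt n q i j) := by
  have hi1 : Sum.inr i ∉ W₁ := by
    intro h; exact (List.nodup_append.mp hW).2.2 _ h _ (by simp) rfl
  have hj1 : Sum.inl j ∉ W₁ := by
    intro h; exact (List.nodup_append.mp hW).2.2 _ h _ (by simp) rfl
  have hi2 : Sum.inr i ∉ W₂ := by
    have := (List.nodup_append.mp hW).2.1; simp at this; tauto
  have hj2 : Sum.inl j ∉ W₂ := by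
    have := (List.nodup_append.mp hW).2.1; simp at this; tauto
  refine (bMix n r).ext fun ⟨a, b⟩ => ?_
  rw [LinearMap.comp_apply, LinearMap.comp_apply, betaAt_basis]
  simp only [wordCoaction, map_sum, map_smul, matrixCoaction_basis, LinearMap.rTensor_tmul]
  -- The side where `β` is applied after the coaction is regrouped by target basis vectors.
  have hR : ∑ p : (Fin r → Fin n) × (Fin r → Fin n), betaAt n q i j (bMix n r p) ⊗ₜ[ℂ]
        ((W₁ ++ Sum.inr i :: Sum.inl j :: W₂).map (factorCoef q p.1 p.2 a b)).prod
      = ∑ p : (Fin r → Fin n) × (Fin r → Fin n), bMix n r p ⊗ₜ[ℂ]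
        ∑ v, ∑ u, betaCoef (q : ℂ) v u (p.1 j) (p.2 i) •
          ((W₁ ++ Sum.inr i :: Sum.inl j :: W₂).map
            (factorCoef q (Function.update p.1 j u) (Function.update p.2 i v) a b)).prod := by
    let G : (Fin r → Fin n) → (Fin r → Fin n) → (Fin r → Fin n) → (Fin r → Fin n) →
        (VPow n r ⊗[ℂ] VdPow n r) ⊗[ℂ] Aq n q := fun a₁ b₁ a₂ b₂ =>
      betaCoef (q : ℂ) (b₁ i) (a₁ j) (a₂ j) (b₂ i) • (bMix n r (a₂, b₂) ⊗ₜ[ℂ]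
        ((W₁ ++ Sum.inr i :: Sum.inl j :: W₂).map (factorCoef q a₁ b₁ a b)).prod)
    calc _ = ∑ a₁, ∑ b₁, ∑ k, ∑ m, G a₁ b₁ (Function.update a₁ j k) (Function.update b₁ i m) := by
          simp only [G, Fintype.sum_prod_type, betaAt_basis, TensorProduct.sum_tmul,
            TensorProduct.smul_tmul', Function.update_self]
      _ = ∑ a₁, ∑ k, ∑ b₁, ∑ m, G a₁ b₁ (Function.update a₁ j k) (Function.update b₁ i m) :=
          Finset.sum_congr rfl fun _ _ => Finset.sum_comm
      _ = ∑ a₁, ∑ k, ∑ b₂, ∑ v, G a₁ (Function.update b₂ i v) (Function.update a₁ j k) b₂ :=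
          Finset.sum_congr rfl fun a₁ _ => Finset.sum_congr rfl fun k _ =>
            sum_update_comm i fun b₁ b₂ => G a₁ b₁ (Function.update a₁ j k) b₂
      _ = ∑ a₂, ∑ u, ∑ b₂, ∑ v, G (Function.update a₂ j u) (Function.update b₂ i v) a₂ b₂ :=
          sum_update_comm j fun a₁ a₂ => ∑ b₂, ∑ v, G a₁ (Function.update b₂ i v) a₂ b₂
      _ = ∑ a₂, ∑ b₂, ∑ v, ∑ u, G (Function.update a₂ j u) (Function.update b₂ i v) a₂ b₂ := by
          refine Finset.sum_congr rfl fun a₂ _ => ?_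
          rw [Finset.sum_comm]
          exact Finset.sum_congr rfl fun b₂ _ => Finset.sum_comm
      _ = _ := by
          simp only [G, Fintype.sum_prod_type, TensorProduct.tmul_sum, TensorProduct.tmul_smul,
            Function.update_self]
  rw [hR]
  have hL : ∀ p : (Fin r → Fin n) × (Fin r → Fin n), 
      ∑ c, ∑ y, betaCoef (q : ℂ) (b i) (a j) c y •
          ((W₁ ++ Sum.inl j :: Sum.inr i :: W₂).map
            (factorCoef q p.1 p.2 (Function.update a j c) (Function.update b i y))).prod
      = ∑ v, ∑ u, betaCoef (q : ℂ) v u (p.1 j) (p.2 i) •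
          ((W₁ ++ Sum.inr i :: Sum.inl j :: W₂).map
            (factorCoef q (Function.update p.1 j u) (Function.update p.2 i v) a b)).prod := by
    intro p
    simp only [List.map_append, List.map_cons, map_factorCoef_update_right hi1 hj1,
      map_factorCoef_update_left hi1 hj1, map_factorCoef_update_right hi2 hj2,
      map_factorCoef_update_left hi2 hj2, List.prod_append, List.prod_cons, factorCoef,
      Function.update_self]
    have := congrArg (fun z => (W₁.map (factorCoef q p.1 p.2 a b)).prod * (z *
      (W₂.map (factorCoef q p.1 p.2 a b)).prod))
      (tStar_mul_t_exchange hq (b i) (a j) (p.1 j) (p.2 i))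
    simpa only [Finset.sum_mul, Finset.mul_sum, smul_mul_assoc, mul_smul_comm, mul_assoc] using this
  simp_rw [← hL, TensorProduct.tmul_sum, Finset.smul_sum, TensorProduct.tmul_smul]
  conv_lhs => enter [2, c]; rw [Finset.sum_comm]
  rw [Finset.sum_comm]

/-- `V_j` travels left past the block of the `V_i^*`. The rightmost operator of the product acts
first, in agreement with the last `V_i^*` being next to `V_j`. -/
theorem betaAt_prod_intertwiner (hq : q ≠ 0) (j : Fin r) (is : List (Fin r))
    (W₁ W₂ : List (Fin r ⊕ Fin r))
    (hW : (W₁ ++ is.map Sum.inr ++ Sum.inl j :: W₂).Nodup) :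
    IsIntertwiner (wordCoaction n q (W₁ ++ is.map Sum.inr ++ Sum.inl j :: W₂))
      (wordCoaction n q (W₁ ++ Sum.inl j :: (is.map Sum.inr ++ W₂)))
      ((is.map fun i => betaAt n q i j).prod : Module.End ℂ _) := by
  induction is generalizing W₁ with
  | nil => simpa using IsIntertwiner.id _
  | cons i is ih =>
    have h1 := ih (W₁ ++ [Sum.inr i]) (by simpa using hW)
    have hp : (W₁ ++ (i :: is).map Sum.inr ++ Sum.inl j :: W₂).Perm
        (W₁ ++ Sum.inr i :: Sum.inl j :: (is.map Sum.inr ++ W₂)) := by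
      simp only [List.map_cons, List.append_assoc, List.cons_append]
      exact (List.Perm.cons _ List.perm_middle).append_left _
    have h2 := betaAt_intertwiner (n := n) hq (hp.nodup_iff.mp hW)
    rw [List.map_cons (f := fun i => betaAt n q i j), List.prod_cons]
    refine IsIntertwiner.comp (g := betaAt n q i j) (by simpa using h2) (by simpa using h1)

/-- The order of the factors when `V_k` has been moved to the left for all `k` in `l₁`. -/
def factorOrder (l₁ l₂ : List (Fin r)) : List (Fin r ⊕ Fin r) :=
  l₁.map Sum.inl ++ l₁.map Sum.inr ++ l₂.flatMap fun j => [Sum.inl j, Sum.inr j]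

theorem nodup_factorOrder {l₁ l₂ : List (Fin r)} (h : (l₁ ++ l₂).Nodup) :
    (factorOrder l₁ l₂).Nodup := by
  have hp : ∀ l : List (Fin r), (l.flatMap fun j => [Sum.inl j, Sum.inr j]).Perm
      (l.map Sum.inl ++ l.map Sum.inr : List (Fin r ⊕ Fin r)) := by
    intro l
    induction l with
    | nil => simp
    | cons k l ih =>
      simp only [List.flatMap_cons, List.map_cons, List.cons_append, List.nil_append]
      exact List.Perm.cons _ ((List.Perm.cons _ ih).trans List.perm_middle.symm)
  rw [List.nodup_append] at h
  rw [factorOrder, (List.Perm.append_left _ (hp l₂)).nodup_iff]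
  simp only [List.nodup_append, List.nodup_map_iff Sum.inl_injective,
    List.nodup_map_iff Sum.inr_injective, h.1, h.2.1]
  have h3 := h.2.2
  simp only [List.mem_map, List.mem_append]
  refine ⟨⟨trivial, trivial, ?_⟩, ⟨trivial, trivial, ?_⟩, ?_⟩
  · rintro _ ⟨x, _, rfl⟩ _ ⟨y, _, rfl⟩; simp
  · rintro _ ⟨x, _, rfl⟩ _ ⟨y, _, rfl⟩; simp
  · rintro _ (⟨x, hx, rfl⟩ | ⟨x, hx, rfl⟩) _ (⟨y, hy, rfl⟩ | ⟨y, hy, rfl⟩)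
    · simpa using h3 x hx y hy
    · simp
    · simp
    · simpa using h3 x hx y hy

/-- `l₁` lists the indices already regrouped. As `List.finRange r` is increasing, the indices below
the next one, `j`, are precisely `l₁`, whose dual factors `V_j` has to pass. -/
theorem betaAt_prod_prod_intertwiner (hq : q ≠ 0) (l₁ l₂ : List (Fin r))
    (h : List.finRange r = l₁ ++ l₂) :
    IsIntertwiner (wordCoaction n q (factorOrder l₁ l₂))
      (wordCoaction n q (factorOrder (l₁ ++ l₂) []))
      ((l₂.reverse.map fun j =>
      (((List.finRange r).filter fun i => i < j).map fun i => betaAt n q i j).prod).prod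
        : Module.End ℂ _) := by
  induction l₂ generalizing l₁ with
  | nil => simpa using IsIntertwiner.id _
  | cons j l₂ ih =>
    have h1 := ih (l₁ ++ [j]) (by simpa using h)
    have hf : (List.finRange r).filter (fun i => i < j) = l₁ := by
      have hs := List.pairwise_lt_finRange r
      rw [h, List.pairwise_append, List.pairwise_cons] at hs
      rw [h, List.filter_append, List.filter_eq_self.mpr, List.filter_eq_nil_iff.mpr,
        List.append_nil]
      · intro i hi
        rcases List.mem_cons.mp hi with rfl | hi
        · simp
        · simpa using (hs.2.1.1 i hi).le
      · intro i hi
        simpa using hs.2.2 i hi j (by simp)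
    have hnd := nodup_factorOrder (h ▸ List.nodup_finRange r)
    have h2 := betaAt_prod_intertwiner (n := n) hq j l₁ (l₁.map Sum.inl)
      (Sum.inr j :: l₂.flatMap fun j => [Sum.inl j, Sum.inr j])
      (by simpa [factorOrder] using hnd)
    rw [List.reverse_cons, List.map_append, List.prod_append, List.map_singleton,
      List.prod_singleton, hf]
    refine IsIntertwiner.comp (g := List.prod _) (by simpa using h1) ?_
    simpa [factorOrder] using h2

theorem regroup_intertwiner : IsIntertwiner (coactSrc n q r)
    (wordCoaction n q (factorOrder [] (List.finRange r))) (regroup n r).toLinearMap := by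
  refine (bSrc n r).ext fun x => ?_
  rw [LinearMap.comp_apply, LinearMap.comp_apply, coactSrc, matrixCoaction_basis, map_sum]
  simp only [LinearMap.rTensor_tmul, LinearEquiv.coe_coe, regroup, Module.Basis.equiv_apply,
    wordCoaction, matrixCoaction_basis]
  rw [← Equiv.sum_comp (Equiv.arrowProdEquivProdArrow (Fin r) (fun _ => Fin n) (fun _ => Fin n))]
  refine Finset.sum_congr rfl fun y _ => ?_
  congr 1
  simp only [factorOrder, List.map_nil, List.nil_append, List.map_flatMap, List.ofFn_eq_map]
  induction List.finRange r with
  | nil => simp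
  | cons k l ih =>
    simp only [List.map_cons, List.prod_cons, List.flatMap_cons, List.prod_append, ← ih]
    simp [factorCoef, Equiv.arrowProdEquivProdArrow]

theorem coaction_lword {ρ : L n q →ₐ[ℂ] L n q ⊗[ℂ] Aq n q} (hρ : IsCoactionL ρ)
    (a : Fin r → Fin n) : ρ (lword q a) = ∑ a' : Fin r → Fin n,
      lword q a' ⊗ₜ[ℂ] (List.ofFn fun k => t q (a' k) (a k)).prod := by
  rw [lword, map_list_prod, List.map_ofFn]
  simp only [Function.comp_def, hρ _]
  exact word_tensor (lv q) (t q) a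

theorem coaction_ldword {ρ : Ld n q →ₐ[ℂ] Ld n q ⊗[ℂ] Aq n q} (hρ : IsCoactionLd ρ)
    (a : Fin r → Fin n) : ρ (ldword q a) = ∑ a' : Fin r → Fin n,
      ldword q a' ⊗ₜ[ℂ] (List.ofFn fun k => tStar q (a' k) (a k)).prod := by
  rw [ldword, map_list_prod, List.map_ofFn]
  simp only [Function.comp_def, hρ _]
  exact word_tensor (ldv q) (tStar q) a

theorem incl_pr_basis (a b : Fin r → Fin n) :
    incl n q r (TensorProduct.map (pr n q r) (prd n q r) (bMix n r (a, b)))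
      = lword q a ⊗ₜ[ℂ] ldword q b := by
  rw [bMix, Module.Basis.tensorProduct_apply, TensorProduct.map_tmul, pr, prd,
    Module.Basis.constr_basis, Module.Basis.constr_basis, incl, TensorProduct.mapIncl,
    TensorProduct.map_tmul]
  rfl

theorem pr_intertwiner {ρ : L n q →ₐ[ℂ] L n q ⊗[ℂ] Aq n q} (hρ : IsCoactionL ρ)
    {ρd : Ld n q →ₐ[ℂ] Ld n q ⊗[ℂ] Aq n q} (hρd : IsCoactionLd ρd) :
    IsIntertwiner (wordCoaction n q (factorOrder (List.finRange r) []))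
      (tensorCoaction ρ.toLinearMap ρd.toLinearMap)
      (incl n q r ∘ₗ TensorProduct.map (pr n q r) (prd n q r)) := by
  refine (bMix n r).ext fun ⟨a, b⟩ => ?_
  rw [LinearMap.comp_apply, LinearMap.comp_apply, LinearMap.comp_apply, incl_pr_basis, wordCoaction,
    matrixCoaction_basis, map_sum]
  simp only [LinearMap.rTensor_tmul, LinearMap.comp_apply]
  rw [tensorCoaction, LinearMap.comp_apply, LinearMap.comp_apply, TensorProduct.map_tmul,
    AlgHom.toLinearMap_apply, AlgHom.toLinearMap_apply, coaction_lword hρ, coaction_ldword hρd]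
  simp only [TensorProduct.sum_tmul, TensorProduct.tmul_sum, map_sum, Fintype.sum_prod_type,
    LinearEquiv.coe_coe, TensorProduct.tensorTensorTensorComm_tmul, LinearMap.lTensor_tmul,
    LinearMap.mul'_apply, incl_pr_basis]
  rw [Finset.sum_comm]
  refine Finset.sum_congr rfl fun a' _ => Finset.sum_congr rfl fun b' _ => ?_
  simp [factorOrder, List.ofFn_eq_map, Function.comp_def, factorCoef]

theorem PsiHat_intertwiner (hq : q ≠ 0) {ρ : L n q →ₐ[ℂ] L n q ⊗[ℂ] Aq n q} (hρ : IsCoactionL ρ)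
    {ρd : Ld n q →ₐ[ℂ] Ld n q ⊗[ℂ] Aq n q} (hρd : IsCoactionLd ρd) :
    IsIntertwiner (coactSrc n q r) (tensorCoaction ρ.toLinearMap ρd.toLinearMap)
      (incl n q r ∘ₗ PsiHat n q r) := by
  rw [PsiHat, ← LinearMap.comp_assoc, Psi]
  exact (pr_intertwiner hρ hρd).comp
    ((betaAt_prod_prod_intertwiner hq [] _ (List.nil_append _).symm).comp regroup_intertwiner)

end Intertwiner

/-! ### Surjectivity of `Ψ̂_r`. -/

section Surjectivity

variable {n r : ℕ} {q : ℝ}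

theorem sum_betaCoef_target {M : Type*} [AddCommMonoid M] [Module ℂ M] (q : ℂ) (i j : Fin n)
    (f : Fin n → Fin n → M) :
    ∑ k, ∑ m, betaCoef q i j k m • f k m =
      (if i = j then q⁻¹ else 1) • f j i
        + (if i = j then q⁻¹ - q else 0) • ∑ k ∈ Finset.univ.filter (· < j), f k k := by
  simp only [betaCoef, add_smul, Finset.sum_add_distrib]
  congr 1
  · rw [Finset.sum_eq_single j, Finset.sum_eq_single i]
    · simp
    · intro c _ hc; simp [hc]
    · simp
    · intro k _ hk; simp [hk]
    · simp
  · rw [Finset.smul_sum, Finset.sum_filter]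
    refine Finset.sum_congr rfl fun k _ => ?_
    rw [Finset.sum_eq_single k]
    · by_cases hij : i = j <;> by_cases hk : k < j <;> simp [hij, hk]
    · intro m _ hm; simp [Ne.symm hm]
    · simp

theorem betaAt_basis_of_ne {i j : Fin r} {a b : Fin r → Fin n} (h : b i ≠ a j) :
    betaAt n q i j (bMix n r (a, b)) = bMix n r (a, b) := by
  rw [betaAt_basis, sum_betaCoef_target (q : ℂ) (b i) (a j) fun k m =>
    bMix n r (Function.update a j k, Function.update b i m)]
  simp [h]

/-- Basis vectors with `b i ≠ a j` are fixed. On the others `β_{ij}` is `q⁻¹` times the identity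
plus terms with a smaller common index, so induction on that index applies. -/
theorem betaAt_surjective (hq : q ≠ 0) (i j : Fin r) :
    Function.Surjective (betaAt n q i j) := by
  have hq' : (q : ℂ) ≠ 0 := by exact_mod_cast hq
  rw [← LinearMap.range_eq_top, eq_top_iff, ← (bMix n r).span_eq, Submodule.span_le]
  rintro _ ⟨⟨a, b⟩, rfl⟩
  by_cases h : b i = a j
  · generalize hk : a j = k at h
    induction k using WellFoundedLT.induction generalizing a b with
    | ind k ih =>
      have h1 := betaAt_basis (n := n) (q := q) i j a b
      rw [sum_betaCoef_target (q : ℂ) (b i) (a j) fun k m =>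
        bMix n r (Function.update a j k, Function.update b i m)] at h1
      rw [if_pos (h.trans hk.symm), if_pos (h.trans hk.symm), Function.update_eq_self,
        Function.update_eq_self] at h1
      have h2 : bMix n r (a, b) = (q : ℂ) • (betaAt n q i j (bMix n r (a, b))
          + (-((q : ℂ)⁻¹ - q)) • ∑ m ∈ Finset.univ.filter (· < a j),
            bMix n r (Function.update a j m, Function.update b i m)) := by
        rw [h1, add_assoc, ← add_smul, add_neg_cancel, zero_smul, add_zero, smul_smul,
          mul_inv_cancel₀ hq', one_smul]
      rw [SetLike.mem_coe, h2]
      refine Submodule.smul_mem _ _ (Submodule.add_mem _ (LinearMap.mem_range_self _ _)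
        (Submodule.smul_mem _ _ (Submodule.sum_mem _ fun m hm => ?_)))
      rw [Finset.mem_filter, hk] at hm
      exact ih m hm.2 _ _ (by simp) (by simp)
  · exact ⟨_, betaAt_basis_of_ne h⟩

theorem surjective_list_prod {M : Type*} [AddCommMonoid M] [Module ℂ M]
    (l : List (Module.End ℂ M)) (h : ∀ f ∈ l, Function.Surjective f) :
    Function.Surjective l.prod := by
  induction l with
  | nil => exact fun x => ⟨x, rfl⟩
  | cons f l ih =>
    rw [List.prod_cons]
    exact (h f (by simp)).comp (ih fun g hg => h g (by simp [hg]))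

theorem pr_surjective : Function.Surjective (pr n q r) := by
  have h : Submodule.span ℂ (Set.range fun a : Fin r → Fin n => lword q a)
      ≤ LinearMap.range ((LPow n q r).subtype ∘ₗ pr n q r) := by
    rw [Submodule.span_le]
    rintro _ ⟨a, rfl⟩
    exact ⟨bVPow n r a, by simp [pr]⟩
  rintro ⟨x, hx⟩
  obtain ⟨y, hy⟩ := h hx
  exact ⟨y, Subtype.ext hy⟩

theorem prd_surjective : Function.Surjective (prd n q r) := by
  have h : Submodule.span ℂ (Set.range fun a : Fin r → Fin n => ldword q a)
      ≤ LinearMap.range ((LdPow n q r).subtype ∘ₗ prd n q r) := by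
    rw [Submodule.span_le]
    rintro _ ⟨a, rfl⟩
    exact ⟨bVdPow n r a, by simp [prd]⟩
  rintro ⟨x, hx⟩
  obtain ⟨y, hy⟩ := h hx
  exact ⟨y, Subtype.ext hy⟩

theorem PsiHat_surjective (hq : q ≠ 0) : Function.Surjective (PsiHat n q r) := by
  rw [PsiHat, LinearMap.coe_comp, Psi, LinearMap.coe_comp]
  refine (TensorProduct.map_surjective pr_surjective prd_surjective).comp
    ((surjective_list_prod _ ?_).comp (regroup n r).surjective)
  intro f hf
  obtain ⟨j, -, rfl⟩ := List.mem_map.mp hf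
  refine surjective_list_prod _ ?_
  intro g hg
  obtain ⟨i, -, rfl⟩ := List.mem_map.mp hg
  exact betaAt_surjective hq i j

end Surjectivity

/-! ### Weight vectors of the tensor power. -/

section Weights

variable {n r : ℕ} {q : ℝ}

theorem IsIntertwiner.weightComp {M N : Type*} [AddCommMonoid M] [Module ℂ M] [AddCommMonoid N]
    [Module ℂ N] {ρ : M →ₗ[ℂ] M ⊗[ℂ] Aq n q} {ρ₂ : N →ₗ[ℂ] N ⊗[ℂ] Aq n q} {f : M →ₗ[ℂ] N}
    (h : IsIntertwiner ρ ρ₂ f) (μ : Fin n → ℤ) (v : M) :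
    weightComp ρ₂ μ (f v) = f (weightComp ρ μ v) := by
  have h1 : ρ₂ (f v) = LinearMap.rTensor (Aq n q) f (ρ v) := LinearMap.congr_fun h v
  simp only [QGrass.weightComp, LinearMap.comp_apply, h1, LinearEquiv.coe_coe]
  induction ρ v using TensorProduct.induction_on with
  | zero => simp
  | tmul x y => simp
  | add x y hx hy => simp only [map_add, hx, hy]

/-- The weight of the basis vector of `(V ⊗ V^*)^{⊗ r}` with index `x`. -/
def srcWeight (x : Fin r → Fin n × Fin n) : Fin n → ℤ :=
  ∑ k, (Pi.single (x k).1 1 - Pi.single (x k).2 1)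

theorem srcWeight_apply (x : Fin r → Fin n × Fin n) (i : Fin n) :
    srcWeight x i = (∑ k, if (x k).1 = i then 1 else 0) - ∑ k, if (x k).2 = i then 1 else 0 := by
  simp [srcWeight, Finset.sum_apply, Pi.single_apply, eq_comm]

theorem prod_zPow_index {ι : Type*} (s : Finset ι) (μ : ι → Fin n → ℤ) :
    ∏ i ∈ s, zPow (μ i) = zPow (∑ i ∈ s, μ i) := by
  classical
  induction s using Finset.induction_on with
  | empty => simp [zPow, AddMonoidAlgebra.one_def]
  | insert a s ha ih => rw [Finset.prod_insert ha, Finset.sum_insert ha, ih, zPow_mul]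

theorem res_prod (hq : q ≠ 0) (y x : Fin r → Fin n × Fin n) :
    res n q (List.ofFn fun k => t q (y k).1 (x k).1 * tStar q (y k).2 (x k).2).prod
      = if y = x then zPow (srcWeight x) else 0 := by
  rw [map_list_prod, List.map_ofFn, List.prod_ofFn]
  simp only [Function.comp_apply, map_mul, res_t, res_tStar hq]
  split_ifs with h
  · subst h
    simp only [if_true, zPow_mul, srcWeight, sub_eq_add_neg]
    exact prod_zPow_index _ _
  · obtain ⟨k, hk⟩ := Function.ne_iff.mp h
    refine Finset.prod_eq_zero (Finset.mem_univ k) ?_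
    by_cases h1 : (y k).1 = (x k).1
    · have h2 : (y k).2 ≠ (x k).2 := fun h2 => hk (Prod.ext h1 h2)
      simp [h2]
    · simp [h1]

theorem weightComp_bSrc (hq : q ≠ 0) (μ : Fin n → ℤ) (x : Fin r → Fin n × Fin n) :
    weightComp (coactSrc n q r) μ (bSrc n r x) = if srcWeight x = μ then bSrc n r x else 0 := by
  rw [weightComp, LinearMap.comp_apply, LinearMap.comp_apply, coactSrc, matrixCoaction_basis,
    map_sum, map_sum]
  simp only [LinearMap.lTensor_tmul, LinearMap.comp_apply, AlgHom.toLinearMap_apply, res_prod hq]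
  rw [Finset.sum_eq_single x]
  · simp [zCoeff, zPow, Finsupp.single_apply]
  · intro y _ hy; simp [hy]
  · simp

theorem pow_vecOf (X : Fin n → Fin n → ℝ) :
    pow r (vecOf X) = ∑ x : Fin r → Fin n × Fin n,
      (∏ k, (X (x k).1 (x k).2 : ℂ)) • bSrc n r x := by
  rw [← (bSrc n r).sum_repr (pow r (vecOf X))]
  refine Finset.sum_congr rfl fun x _ => ?_
  congr 1
  rw [pow, bSrc, Basis.piTensorProduct_repr_tprod_apply]
  refine Finset.prod_congr rfl fun k _ => ?_
  have h : vecOf X = ∑ p : Fin n × Fin n, (X p.1 p.2 : ℂ) • bVVd n p := by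
    simp only [vecOf, Fintype.sum_prod_type, bVVd, Module.Basis.tensorProduct_apply]
  rw [h, Module.Basis.repr_sum_self]

/-- When no index of a `V^*` factor equals an index of a `V` factor, every `β_{ij}` is a flip, which
is the identity under the labelling of factors. -/
theorem PsiHat_bSrc_of_ne {a b : Fin r → Fin n} (h : ∀ i j, b i ≠ a j) :
    incl n q r (PsiHat n q r (bSrc n r fun k => (a k, b k))) = lword q a ⊗ₜ[ℂ] ldword q b := by
  have h1 : regroup n r (bSrc n r fun k => (a k, b k)) = bMix n r (a, b) := by
    rw [regroup, Module.Basis.equiv_apply]; rfl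
  have h2 : ∀ l : List (Module.End ℂ (VPow n r ⊗[ℂ] VdPow n r)),
      (∀ f ∈ l, f (bMix n r (a, b)) = bMix n r (a, b)) → l.prod (bMix n r (a, b)) = bMix n r (a, b) := by
    intro l hl
    induction l with
    | nil => rfl
    | cons f l ih =>
      rw [List.prod_cons, Module.End.mul_apply, ih fun g hg => hl g (by simp [hg]),
        hl f (by simp)]
  rw [PsiHat, LinearMap.comp_apply, Psi, LinearMap.comp_apply, LinearEquiv.coe_coe, h1, h2,
    incl_pr_basis]
  intro f hf
  obtain ⟨j, -, rfl⟩ := List.mem_map.mp hf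
  refine h2 _ ?_
  intro g hg
  obtain ⟨i, -, rfl⟩ := List.mem_map.mp hg
  exact betaAt_basis_of_ne (h i j)

end Weights

/-! ### Powers of a sum of `q`-commuting elements of square zero. -/

section PowerSum

variable {n : ℕ} {B : Type*} [Ring B] [Algebra ℂ B]

/-- The `q`-binomial theorem, cut off after the linear term because `x * x = 0`. -/
theorem add_pow_of_mul_self_eq_zero {p : ℂ} {x y : B} (hx : x * x = 0) (hyx : y * x = p • (x * y))
    (m : ℕ) :
    (x + y) ^ (m + 1) = y ^ (m + 1) + (∑ k ∈ Finset.range (m + 1), p ^ k) • (x * y ^ m) := by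
  induction m with
  | zero => simp [add_comm]
  | succ m ih =>
    rw [pow_succ', ih, add_mul, mul_add, mul_add, mul_smul_comm, mul_smul_comm, ← mul_assoc x x,
      hx, zero_mul, smul_zero, add_zero, ← mul_assoc y x, hyx, smul_mul_assoc, mul_assoc,
      ← pow_succ', ← pow_succ', smul_smul, Finset.sum_range_succ' (fun k => p ^ k) (m + 1), add_smul, pow_zero,
      one_smul, Finset.sum_mul]
    simp only [← pow_succ]
    abel

/-- The smallest index is split off. The vanishing of the next power is carried through the
induction because it removes the term `y ^ (m + 1)` of the binomial formula. -/
theorem IsExterior.sum_pow {p : ℂ} {e : Fin n → B} (he : IsExterior (-p) e)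
    (I : Finset (Fin n)) :
    (∑ i ∈ I, e i) ^ I.card
      = (∏ j ∈ Finset.range I.card, ∑ k ∈ Finset.range (j + 1), p ^ k) • extProd e I ∧
    (∑ i ∈ I, e i) ^ (I.card + 1) = 0 := by
  induction I using Finset.induction_on_min with
  | empty => simp [extProd]
  | insert x I hx ih =>
    have hxI : x ∉ I := fun h => lt_irrefl _ (hx x h)
    have hyx : (∑ i ∈ I, e i) * e x = p • (e x * ∑ i ∈ I, e i) := by
      rw [Finset.sum_mul, Finset.mul_sum, Finset.smul_sum]
      refine Finset.sum_congr rfl fun i hi => ?_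
      rw [he.swap x i (hx i hi), neg_neg]
    have hext : e x * extProd e I = extProd e (insert x I) := by
      rw [he.mul_extProd hxI, Finset.filter_false_of_mem fun i hi => (hx i hi).not_gt]
      simp
    rw [Finset.card_insert_of_notMem hxI, Finset.sum_insert hxI]
    constructor
    · rw [add_pow_of_mul_self_eq_zero (he.sq x) hyx, ih.2, zero_add, ih.1, mul_smul_comm, hext,
        smul_smul, Finset.prod_range_succ, mul_comm]
    · rw [add_pow_of_mul_self_eq_zero (he.sq x) hyx, ih.2, mul_zero, smul_zero, add_zero, pow_succ,
        ih.2, zero_mul]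

theorem sum_pow_eq_sum_words {B : Type*} [Ring B] (e : Fin n → B) (I : Finset (Fin n)) (r : ℕ) :
    (∑ i ∈ I, e i) ^ r = ∑ a : Fin r → Fin n,
      if ∀ k, a k ∈ I then (List.ofFn fun k => e (a k)).prod else 0 := by
  induction r with
  | zero => simp
  | succ r ih =>
    rw [pow_succ', ih, ← (Fin.consEquiv fun _ => Fin n).sum_comp, Fintype.sum_prod_type,
      Finset.sum_mul, ← Finset.sum_filter_add_sum_filter_not Finset.univ (· ∈ I)]
    simp only [Finset.filter_mem_eq_inter, Finset.univ_inter]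
    symm
    rw [add_eq_left.mpr]
    · refine Finset.sum_congr rfl fun i hi => ?_
      rw [Finset.mul_sum]
      refine Finset.sum_congr rfl fun a _ => ?_
      simp [List.ofFn_succ, Fin.consEquiv, Fin.forall_fin_succ, hi]
    · refine Finset.sum_eq_zero fun i hi => Finset.sum_eq_zero fun a _ => ?_
      rw [if_neg]
      intro h
      exact (Finset.mem_filter.mp hi).2 (by simpa [Fin.consEquiv] using h 0)

/-- Expanding the `r`-th power of the sum over `I` gives all words in `I`; those with a repetition
vanish, and the rest exhaust `I`. -/
theorem IsExterior.sum_words {p : ℂ} (hp : p ≠ 0) {e : Fin n → B} (he : IsExterior (-p) e)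
    {r : ℕ} {I : Finset (Fin n)} (hI : I.card = r) :
    ∑ a : Fin r → Fin n with Function.Injective a ∧ Finset.univ.image a = I,
        (List.ofFn fun k => e (a k)).prod
      = (∏ j ∈ Finset.range r, ∑ k ∈ Finset.range (j + 1), p ^ k) • extProd e I := by
  rw [← hI, ← (he.sum_pow I).1, hI, sum_pow_eq_sum_words, Finset.sum_filter]
  refine Finset.sum_congr rfl fun a _ => ?_
  by_cases ha : Function.Injective a
  · congr 1
    rw [eq_iff_iff]
    constructor
    · rintro ⟨-, rfl⟩ k
      simp
    · intro h
      refine ⟨ha, Finset.eq_of_subset_of_card_le ?_ ?_⟩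
      · intro i hi
        obtain ⟨k, -, rfl⟩ := Finset.mem_image.mp hi
        exact h k
      · rw [Finset.card_image_of_injective _ ha, hI]; simp
  · rw [he.word_eq_zero (neg_ne_zero.mpr hp) ha]; simp

end PowerSum

/-! ### Which basis tensors have a weight `ν^♭` in the orbit. -/

section Orbit

variable {n l r : ℕ}

theorem mem_orbit_iff (hrl : r ≤ l) (ν : Fin l → ℤ) :
    ν ∈ orbit l r ↔ (∀ i, ν i = 0 ∨ ν i = 1 ∨ ν i = -1) ∧
      (Finset.univ.filter fun i => ν i ≠ 0).card = r := by
  have hcard : (Finset.univ.filter fun i : Fin l => (i : ℕ) < r).card = r := by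
    rw [Fin.card_filter_val_lt]; omega
  simp only [orbit, Finset.mem_image, Finset.mem_univ, true_and]
  constructor
  · rintro ⟨⟨w, s⟩, rfl⟩
    constructor
    · intro i
      rcases Int.units_eq_one_or (w i) with h | h <;> by_cases h' : (s i : ℕ) < r <;> simp [h, h']
    · refine Eq.trans ?_ hcard
      refine Finset.card_bij (fun i _ => s i) ?_ (fun _ _ _ _ h => s.injective h) ?_
      · intro i hi; simpa using hi
      · intro i hi; exact ⟨s.symm i, by simpa using hi, by simp⟩
  · rintro ⟨h1, h2⟩
    have hc : Fintype.card {i // ν i ≠ 0} = Fintype.card {i : Fin l // (i : ℕ) < r} := by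
      rw [Fintype.card_subtype, Fintype.card_subtype, h2, hcard]
    -- Any bijection from the support of `ν` to the first `r` positions extends to a permutation;
    -- the signs are read off from `ν`.
    let e := Fintype.equivOfCardEq hc
    refine ⟨⟨fun i => if ν i = -1 then -1 else 1, e.extendSubtype⟩, ?_⟩
    funext i
    by_cases hi : ν i = 0
    · have := e.extendSubtype_not_mem i (by simpa using hi)
      simp [hi, this]
    · have := e.extendSubtype_mem i hi
      rcases h1 i with h | h | h
      · exact absurd h hi
      · simp [h, this]
      · simp [h, this]

theorem flat_rev (hln : 2 * l ≤ n) (ν : Fin l → ℤ) (i : Fin n) :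
    flat n ν i.rev = -flat n ν i := by
  have := i.isLt
  have h2 : (i.rev : ℕ) = n - (i + 1) := Fin.val_rev i
  unfold flat
  by_cases h : (i : ℕ) < l
  · have h' : ¬ (i.rev : ℕ) < l := by omega
    simp [h, h', -Fin.val_rev]
  · by_cases h' : (i.rev : ℕ) < l <;> simp [h, h', -Fin.val_rev]

theorem flat_castLE (hln : l ≤ n) (ν : Fin l → ℤ) (j : Fin l) :
    flat n ν (Fin.castLE hln j) = ν j := by
  simp [flat]

theorem flat_injective (hln : l ≤ n) : Function.Injective (flat n : (Fin l → ℤ) → Fin n → ℤ) := by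
  intro ν ν' h
  funext j
  rw [← flat_castLE hln ν, h, flat_castLE hln]

/-- Each nonzero `ν j` produces an entry `1`, at `j` or at its mirror position according to its
sign. -/
theorem le_card_flat_eq_one (hrl : r ≤ l) (hln : 2 * l ≤ n) {ν : Fin l → ℤ} (hν : ν ∈ orbit l r) :
    r ≤ (Finset.univ.filter fun i => flat n ν i = 1).card := by
  have hln' : l ≤ n := by omega
  obtain ⟨h1, h2⟩ := (mem_orbit_iff hrl ν).mp hν
  rw [← h2]
  refine Finset.card_le_card_of_injOn
    (fun j => if ν j = 1 then Fin.castLE hln' j else (Fin.castLE hln' j).rev) ?_ ?_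
  · intro j hj
    have hj' : ν j ≠ 0 := by simpa using hj
    simp only [Finset.coe_filter, Finset.mem_univ, true_and, Set.mem_ofPred_eq]
    split_ifs with h
    · rw [flat_castLE, h]
    · rw [flat_rev hln, flat_castLE]
      rcases h1 j with h3 | h3 | h3
      · exact absurd h3 hj'
      · exact absurd h3 h
      · rw [h3]; rfl
  · intro j _ j' _ h
    have hj := j.isLt
    have hj' := j'.isLt
    dsimp only at h
    split_ifs at h <;> simp only [Fin.ext_iff, Fin.val_castLE, Fin.val_rev] at h ⊢ <;> omega

theorem mem_idx_iff {I : Finset (Fin n)} : I ∈ idx n l r ↔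
    (∀ i ∈ I, (i : ℕ) < l ∨ (i.rev : ℕ) < l) ∧ I.card = r ∧ ∀ i ∈ I, i.rev ∉ I := by
  simp only [idx, Finset.mem_filter, Finset.mem_univ, true_and]
  refine and_congr_right fun _ => and_congr_right fun _ => ?_
  rw [Finset.eq_empty_iff_forall_notMem]
  constructor
  · intro h i hi hi'
    exact h i.rev (Finset.mem_inter.mpr ⟨hi', Finset.mem_image_of_mem _ hi⟩)
  · intro h i hi
    rw [Finset.mem_inter, Finset.mem_image] at hi
    obtain ⟨hi, j, hj, rfl⟩ := hi
    exact h j hj hi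

/-- A pigeonhole argument: each position of weight `1` needs a factor whose `V` index lies there,
and there are only `r` factors for at least `r` positions. Hence the `V` indices enumerate these
positions once each. -/
theorem exists_word_of_srcWeight (hrl : r ≤ l) (hln : 2 * l ≤ n) {x : Fin r → Fin n × Fin n}
    (hx : ∀ k, (x k).1 = (x k).2 ∨
      ((x k).2 = (x k).1.rev ∧ (((x k).1 : ℕ) < l ∨ ((x k).1.rev : ℕ) < l)))
    {ν : Fin l → ℤ} (hν : ν ∈ orbit l r) (hw : srcWeight x = flat n ν) :
    ∃ a : Fin r → Fin n, (Function.Injective a ∧ Finset.univ.image a ∈ idx n l r) ∧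
      (fun k => (a k, (a k).rev)) = x := by
  let a : Fin r → Fin n := fun k => (x k).1
  have hsub : (Finset.univ.filter fun i => flat n ν i = 1) ⊆ Finset.univ.image a := by
    intro i hi
    by_contra hne
    have hk : ∀ k, (x k).1 ≠ i := fun k hk => hne (by simpa using ⟨k, hk⟩)
    have h1 : srcWeight x i = 1 := by rw [hw]; simpa using hi
    rw [srcWeight_apply] at h1
    simp only [hk, if_false, Finset.sum_const_zero, zero_sub] at h1
    have : (0 : ℤ) ≤ ∑ k, if (x k).2 = i then 1 else 0 :=
      Finset.sum_nonneg fun k _ => by split_ifs <;> norm_num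
    linarith
  have hle : (Finset.univ.image a).card ≤ r := by simpa using Finset.card_image_le (s := Finset.univ) (f := a)
  have hge := le_card_flat_eq_one hrl hln hν
  have heq := Finset.eq_of_subset_of_card_le hsub (hle.trans hge)
  have hcard : (Finset.univ.image a).card = r := le_antisymm hle (hge.trans (Finset.card_le_card hsub))
  have ha : Function.Injective a := by
    have : Set.InjOn a (Finset.univ : Finset (Fin r)) :=
      Finset.card_image_iff.mp (by rw [hcard]; simp)
    simpa using this
  have hfl : ∀ k, flat n ν (a k) = 1 := by
    intro k
    have : a k ∈ Finset.univ.filter fun i => flat n ν i = 1 := by rw [heq]; simp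
    simpa using this
  -- A diagonal factor would contribute `-1` at `a k`, where only one factor contributes `+1`, so
  -- the weight there could not be `1`.
  have hrev : ∀ k, (x k).2 = (a k).rev ∧ ((a k : ℕ) < l ∨ ((a k).rev : ℕ) < l) := by
    intro k
    refine (hx k).resolve_left fun h => ?_
    have h1 : srcWeight x (a k) = 1 := by rw [hw, hfl]
    rw [srcWeight_apply] at h1
    have h2 : (∑ k', if (x k').1 = a k then (1 : ℤ) else 0) = 1 := by
      rw [Finset.sum_eq_single k]
      · simp [a]
      · intro k' _ hk'; rw [if_neg]; exact fun h => hk' (ha h)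
      · simp
    have h3 : (1 : ℤ) ≤ ∑ k', if (x k').2 = a k then 1 else 0 := by
      have := Finset.single_le_sum (f := fun k' => if (x k').2 = a k then (1 : ℤ) else 0)
        (fun k' _ => by split_ifs <;> norm_num) (Finset.mem_univ k)
      simpa [a, h] using this
    linarith
  refine ⟨a, ⟨ha, mem_idx_iff.mpr ⟨?_, hcard, ?_⟩⟩, ?_⟩
  · intro i hi
    obtain ⟨k, -, rfl⟩ := Finset.mem_image.mp hi
    exact (hrev k).2
  · intro i hi hi'
    rw [← heq, Finset.mem_filter] at hi hi'
    have := flat_rev hln ν i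
    rw [hi.2, hi'.2] at this
    norm_num at this
  · funext k
    exact Prod.ext rfl (hrev k).1.symm

theorem srcWeight_word {a : Fin r → Fin n} (ha : Function.Injective a) (i : Fin n) :
    srcWeight (fun k => (a k, (a k).rev)) i =
      (if i ∈ Finset.univ.image a then 1 else 0) - if i.rev ∈ Finset.univ.image a then 1 else 0 := by
  have h : ∀ j, (∑ k, if a k = j then (1 : ℤ) else 0)
      = if j ∈ Finset.univ.image a then 1 else 0 := by
    intro j
    split_ifs with hj
    · obtain ⟨k, -, rfl⟩ := Finset.mem_image.mp hj
      rw [Finset.sum_eq_single k]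
      · simp
      · intro k' _ hk'; rw [if_neg]; exact fun h => hk' (ha h)
      · simp
    · refine Finset.sum_eq_zero fun k _ => ?_
      rw [if_neg]
      rintro rfl
      exact hj (by simp)
  rw [srcWeight_apply, ← h i, ← h i.rev]
  simp only [Fin.rev_eq_iff]

theorem exists_orbit_of_word (hrl : r ≤ l) (hln : 2 * l ≤ n) {a : Fin r → Fin n}
    (ha : Function.Injective a) (hI : Finset.univ.image a ∈ idx n l r) :
    ∃ ν ∈ orbit l r, srcWeight (fun k => (a k, (a k).rev)) = flat n ν := by
  have hln' : l ≤ n := by omega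
  obtain ⟨h1, h2, h3⟩ := mem_idx_iff.mp hI
  set I := Finset.univ.image a with hIdef
  set W := srcWeight (fun k => (a k, (a k).rev)) with hW
  have hw : ∀ i, W i = (if i ∈ I then 1 else 0) - if i.rev ∈ I then 1 else 0 := srcWeight_word ha
  refine ⟨fun j => W (Fin.castLE hln' j), (mem_orbit_iff hrl _).mpr ⟨?_, ?_⟩, ?_⟩
  · intro j
    rw [hw]
    split_ifs <;> simp
  · rw [← h2]
    refine Finset.card_bij (fun j _ => if Fin.castLE hln' j ∈ I then Fin.castLE hln' j
      else (Fin.castLE hln' j).rev) ?_ ?_ ?_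
    · intro j hj
      rw [Finset.mem_filter, hw] at hj
      by_cases h : Fin.castLE hln' j ∈ I
      · simp [h]
      · by_cases h' : (Fin.castLE hln' j).rev ∈ I
        · simp [h, h']
        · simp [h, h'] at hj
    · intro j _ j' _ h
      have hj := j.isLt
      have hj' := j'.isLt
      split_ifs at h <;> simp only [Fin.ext_iff, Fin.val_castLE, Fin.val_rev] at h ⊢ <;> omega
    · intro i hi
      rcases h1 i hi with h | h
      · have hc : Fin.castLE hln' ⟨i, h⟩ = i := rfl
        refine ⟨⟨i, h⟩, ?_, ?_⟩
        · simp [hc, hw, hi, h3 i hi]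
        · simp [hc, hi]
      · have hc : Fin.castLE hln' ⟨i.rev, h⟩ = i.rev := rfl
        refine ⟨⟨i.rev, h⟩, ?_, ?_⟩
        · rw [Finset.mem_filter, hc, hw, Fin.rev_rev, if_neg (h3 i hi), if_pos hi]
          simp
        · rw [hc, if_neg (h3 i hi), Fin.rev_rev]
  · funext i
    unfold flat
    split_ifs with h h'
    · rfl
    · have hc : Fin.castLE hln' ⟨i.rev, h'⟩ = i.rev := rfl
      change W i = -W (Fin.castLE hln' ⟨i.rev, h'⟩)
      rw [hc, hw, hw, Fin.rev_rev, neg_sub]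
    · have h4 : i ∉ I := fun hi => by have := h1 i hi; tauto
      have h5 : i.rev ∉ I := fun hi => by
        have := h1 _ hi
        rw [Fin.rev_rev] at this
        tauto
      rw [hw]; simp [h4, h5]

end Orbit

/-! ### The principal term for a matrix supported on the two diagonals. -/

section PrincipalTerm

variable {n l r : ℕ} {q : ℝ}

/-- Each tensor factor contributes `-q` to a swap, together `q²`; hence the parameter `-q²` in the
convention of `IsExterior`. -/
theorem isExterior_lv_tmul_ldv (hq : q ≠ 0) :
    IsExterior (-((q : ℂ) ^ 2)) fun i : Fin n => lv q i ⊗ₜ[ℂ] ldv q i.rev where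
  sq i := by
    rw [Algebra.TensorProduct.tmul_mul_tmul, (isExterior_lv hq).sq, TensorProduct.zero_tmul]
  swap i j h := by
    rw [Algebra.TensorProduct.tmul_mul_tmul, Algebra.TensorProduct.tmul_mul_tmul,
      (isExterior_lv hq).swap i j h, (isExterior_ldv hq).swap i j h, TensorProduct.smul_tmul_smul]
    congr 1; ring

theorem prod_map_tmul {ι A B : Type*} [Ring A] [Algebra ℂ A] [Ring B] [Algebra ℂ B] (f : ι → A)
    (g : ι → B) (l : List ι) :
    (l.map fun i => f i ⊗ₜ[ℂ] g i).prod = (l.map f).prod ⊗ₜ[ℂ] (l.map g).prod := by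
  induction l with
  | nil => rfl
  | cons i l ih => simp [ih]

theorem reverse_sort_image_rev (I : Finset (Fin n)) :
    ((I.image Fin.rev).sort (· ≤ ·)).reverse = (I.sort (· ≤ ·)).map Fin.rev := by
  refine List.Perm.eq_of_pairwise' (r := (· ≥ ·)) ?_ ?_ ?_
  · rw [List.pairwise_reverse]
    exact Finset.pairwise_sort _ (· ≤ ·)
  · rw [List.pairwise_map]
    exact (Finset.pairwise_sort I (· ≤ ·)).imp fun h => Fin.rev_le_rev.mpr h
  · refine (List.reverse_perm _).trans ?_
    rw [← Multiset.coe_eq_coe, Finset.sort_eq, ← Multiset.map_coe, Finset.sort_eq,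
      Finset.image_val_of_injOn Fin.rev_injective.injOn]

/-- The decreasing order in `v_I^*` matches the increasing order in `v_I` under `Fin.rev`, so no
power of `q` appears. -/
theorem extProd_lv_tmul_ldv (I : Finset (Fin n)) :
    extProd (fun i => lv q i ⊗ₜ[ℂ] ldv q i.rev) I = vI q I ⊗ₜ[ℂ] vdI q (I.image Fin.rev) := by
  rw [extProd, prod_map_tmul, vI, vdI, reverse_sort_image_rev, List.map_map]
  rfl

theorem lword_tmul_ldword (a : Fin r → Fin n) :
    lword q a ⊗ₜ[ℂ] ldword q (fun k => (a k).rev)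
      = (List.ofFn fun k => lv q (a k) ⊗ₜ[ℂ] ldv q (a k).rev).prod := by
  rw [lword, ldword, List.ofFn_eq_map, List.ofFn_eq_map, List.ofFn_eq_map, prod_map_tmul]

theorem principalTerm_PsiHat (hq : q ≠ 0) (hrl : r ≤ l) (hln : 2 * l ≤ n)
    {ρ : L n q →ₐ[ℂ] L n q ⊗[ℂ] Aq n q} (hρ : IsCoactionL ρ)
    {ρd : Ld n q →ₐ[ℂ] Ld n q ⊗[ℂ] Aq n q} (hρd : IsCoactionLd ρd) (X : Fin n → Fin n → ℝ)
    (hX : ∀ i j, X i j ≠ 0 → i = j ∨ (j = i.rev ∧ ((i : ℕ) < l ∨ (i.rev : ℕ) < l))) :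
    principalTerm (tensorCoaction ρ.toLinearMap ρd.toLinearMap) l r
        (incl n q r (PsiHat n q r (pow r (vecOf X))))
      = ∑ I ∈ idx n l r, ((∏ i ∈ I, (X i i.rev : ℂ)) *
          ∏ j ∈ Finset.range r, ∑ k ∈ Finset.range (j + 1), ((q : ℂ) ^ 2) ^ k) •
            (vI q I ⊗ₜ[ℂ] vdI q (I.image Fin.rev)) := by
  classical
  have hq' : (q : ℂ) ^ 2 ≠ 0 := pow_ne_zero _ (by exact_mod_cast hq)
  let Φ : Src n r →ₗ[ℂ] L n q ⊗[ℂ] Ld n q := incl n q r ∘ₗ PsiHat n q r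
  have hΦ := PsiHat_intertwiner (r := r) hq hρ hρd
  let S : Finset (Fin r → Fin n) := Finset.univ.filter fun a =>
    Function.Injective a ∧ Finset.univ.image a ∈ idx n l r
  calc _ = ∑ ν ∈ orbit l r, ∑ x : Fin r → Fin n × Fin n, (∏ k, (X (x k).1 (x k).2 : ℂ)) •
        (if srcWeight x = flat n ν then Φ (bSrc n r x) else 0) := by
        refine Finset.sum_congr rfl fun ν _ => ?_
        refine (hΦ.weightComp (flat n ν) (pow r (vecOf X))).trans ?_
        rw [pow_vecOf, map_sum, map_sum]
        refine Finset.sum_congr rfl fun x _ => ?_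
        rw [map_smul, map_smul, weightComp_bSrc hq, apply_ite Φ, map_zero]
    _ = ∑ x : Fin r → Fin n × Fin n, ∑ ν ∈ orbit l r, (∏ k, (X (x k).1 (x k).2 : ℂ)) •
        (if srcWeight x = flat n ν then Φ (bSrc n r x) else 0) := Finset.sum_comm
    _ = ∑ a ∈ S, (∏ k, (X (a k) (a k).rev : ℂ)) •
        (List.ofFn fun k => lv q (a k) ⊗ₜ[ℂ] ldv q (a k).rev).prod := by
        symm
        -- A tensor outside the image of the antidiagonal words has a zero coefficient or a weight
        -- outside the orbit; one in the image has exactly one orbit weight, as `flat` is injective.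
        refine Finset.sum_of_injOn (fun a k => (a k, (a k).rev)) ?_ (by simp) ?_ ?_
        · intro a _ a' _ h
          funext k
          exact congrArg Prod.fst (congrFun h k)
        · intro x _ hx
          refine Finset.sum_eq_zero fun ν hν => ?_
          by_cases hz : ∀ k, X (x k).1 (x k).2 ≠ 0
          · rw [if_neg, smul_zero]
            intro hw
            obtain ⟨a, ha, hax⟩ := exists_word_of_srcWeight hrl hln (fun k => hX _ _ (hz k)) hν hw
            exact hx ⟨a, by simpa [S] using ha, hax⟩
          · push Not at hz
            obtain ⟨k, hk⟩ := hz
            rw [Finset.prod_eq_zero (Finset.mem_univ k) (by simp [hk]), zero_smul]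
        · intro a ha
          obtain ⟨ha, hI⟩ := (Finset.mem_filter.mp ha).2
          obtain ⟨ν, hν, hw⟩ := exists_orbit_of_word hrl hln ha hI
          rw [Finset.sum_eq_single ν, if_pos hw]
          · congr 1
            rw [← lword_tmul_ldword]
            refine (PsiHat_bSrc_of_ne fun i j h => ?_).symm
            exact (mem_idx_iff.mp hI).2.2 (a i) (by simp) (by rw [h]; simp)
          · intro ν' _ hne
            rw [if_neg, smul_zero]
            intro h
            exact hne (flat_injective (by omega) (h.symm.trans hw))
          · exact fun h => absurd hν h
    _ = ∑ I ∈ idx n l r, ∑ a ∈ S with Finset.univ.image a = I, (∏ k, (X (a k) (a k).rev : ℂ)) •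
        (List.ofFn fun k => lv q (a k) ⊗ₜ[ℂ] ldv q (a k).rev).prod :=
        (Finset.sum_fiberwise_of_maps_to (fun a ha => (Finset.mem_filter.mp ha).2.2) _).symm
    _ = _ := by
        refine Finset.sum_congr rfl fun I hI => ?_
        have hS : S.filter (fun a => Finset.univ.image a = I)
            = Finset.univ.filter fun a : Fin r → Fin n =>
              Function.Injective a ∧ Finset.univ.image a = I := by
          ext a
          simp only [S, Finset.mem_filter, Finset.mem_univ, true_and]
          constructor
          · rintro ⟨⟨h1, -⟩, h2⟩; exact ⟨h1, h2⟩
          · rintro ⟨h1, rfl⟩; exact ⟨⟨h1, hI⟩, rfl⟩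
        rw [hS, mul_smul, ← extProd_lv_tmul_ldv,
          ← (isExterior_lv_tmul_ldv hq).sum_words hq' (mem_idx_iff.mp hI).2.1, Finset.smul_sum]
        refine Finset.sum_congr rfl fun a ha => ?_
        obtain ⟨hinj, himg⟩ := (Finset.mem_filter.mp ha).2
        -- The product of matrix entries depends only on the set `I`, not on the ordering `a`.
        rw [← himg, Finset.prod_image fun _ _ _ _ h => hinj h]

end PrincipalTerm

/-! ### Evaluation of the constants. -/

section Constants

variable {n l r : ℕ} {q σ : ℝ}

theorem J_ne_zero {i j : Fin n} (h : J n l q σ i j ≠ 0) :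
    i = j ∨ (j = i.rev ∧ ((i : ℕ) < l ∨ (i.rev : ℕ) < l)) := by
  by_contra hc
  push Not at hc
  obtain ⟨h1, h2⟩ := hc
  refine h ?_
  have h3 : ¬ (j = i.rev ∧ (i : ℕ) < l) := fun ⟨h3, h4⟩ => absurd h4 (not_lt.mpr (h2 h3).1)
  have h4 : ¬ (i = j.rev ∧ (j : ℕ) < l) := by
    rintro ⟨rfl, h4⟩
    have := (h2 (Fin.rev_rev j).symm).2
    rw [Fin.rev_rev] at this
    omega
  simp [J, h1, h3, h4]

theorem Jt_ne_zero {i j : Fin n} (h : Jt n l q σ i j ≠ 0) :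
    i = j ∨ (j = i.rev ∧ ((i : ℕ) < l ∨ (i.rev : ℕ) < l)) := by
  by_contra hc
  push Not at hc
  obtain ⟨h1, h2⟩ := hc
  refine h ?_
  have h3 : ¬ (j = i.rev ∧ (i : ℕ) < l) := fun ⟨h3, h4⟩ => absurd h4 (not_lt.mpr (h2 h3).1)
  have h4 : ¬ (i = j.rev ∧ (j : ℕ) < l) := by
    rintro ⟨rfl, h4⟩
    have := (h2 (Fin.rev_rev j).symm).2
    rw [Fin.rev_rev] at this
    omega
  simp [Jt, h1, h3, h4]

theorem ne_rev_of_outer (hln : 2 * l ≤ n) {i : Fin n} (hi : (i : ℕ) < l ∨ (i.rev : ℕ) < l) :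
    i ≠ i.rev ∧ ((i.rev : ℕ) < l ↔ ¬ (i : ℕ) < l) := by
  have := i.isLt
  rw [Fin.val_rev] at *
  rw [Ne, Fin.ext_iff, Fin.val_rev]
  omega

theorem J_rev (hln : 2 * l ≤ n) {i : Fin n} (hi : (i : ℕ) < l ∨ (i.rev : ℕ) < l) :
    J n l q σ i i.rev = -q ^ σ := by
  obtain ⟨h1, h2⟩ := ne_rev_of_outer hln hi
  by_cases h : (i : ℕ) < l <;> simp [J, h1, h2, h, -Fin.val_rev]

theorem Jt_rev (hln : 2 * l ≤ n) {i : Fin n} (hi : (i : ℕ) < l ∨ (i.rev : ℕ) < l) :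
    Jt n l q σ i i.rev = -(q ^ (σ - 1) * q ^ (2 * (((i : ℕ) : ℤ) + 1 - (l : ℤ)))) := by
  obtain ⟨h1, h2⟩ := ne_rev_of_outer hln hi
  by_cases h : (i : ℕ) < l <;> simp [Jt, h1, h2, h, -Fin.val_rev]

/-- Each factor `1 - q^{2j}` is `1 - q²` times a geometric sum; the denominators `q² - 1` then leave
one sign per factor, absorbed in `-z`. -/
theorem qPoch_eq (hq0 : 0 < q) (hq1 : q < 1) (z : ℝ) (r : ℕ) :
    (z / (q ^ 2 - 1)) ^ r * qPoch (q ^ 2) (q ^ 2) r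
      = (-z) ^ r * ∏ j ∈ Finset.range r, ∑ k ∈ Finset.range (j + 1), (q ^ 2) ^ k := by
  have h1 : q ^ 2 ≠ 1 := by nlinarith
  have h2 : q ^ 2 - 1 ≠ 0 := sub_ne_zero.mpr h1
  induction r with
  | zero => simp [qPoch]
  | succ r ih =>
    rw [qPoch, Finset.prod_range_succ, ← qPoch, pow_succ _ r, pow_succ (-z) r, Finset.prod_range_succ,
      geom_sum_eq h1]
    have key : z / (q ^ 2 - 1) * (1 - (q ^ 2) ^ r * q ^ 2)
        = -z * (((q ^ 2) ^ (r + 1) - 1) / (q ^ 2 - 1)) := by ring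
    calc _ = ((z / (q ^ 2 - 1)) ^ r * qPoch (q ^ 2) (q ^ 2) r)
          * (z / (q ^ 2 - 1) * (1 - (q ^ 2) ^ r * q ^ 2)) := by ring
      _ = _ := by rw [ih, key]; ring

theorem qPoch_ne_zero (hq0 : 0 < q) (hq1 : q < 1) (r : ℕ) : qPoch (q ^ 2) (q ^ 2) r ≠ 0 := by
  rw [qPoch, Finset.prod_ne_zero_iff]
  intro j _
  rw [← pow_succ]
  have : (q ^ 2) ^ (j + 1) < 1 := pow_lt_one₀ (by positivity) (by nlinarith) (by omega)
  linarith

theorem c_ne_zero (hq0 : 0 < q) (hq1 : q < 1) : c q r σ ≠ 0 := by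
  have h2 : q ^ 2 - 1 ≠ 0 := by nlinarith
  exact mul_ne_zero (pow_ne_zero _ (div_ne_zero (Real.rpow_pos_of_pos hq0 σ).ne' h2))
    (qPoch_ne_zero hq0 hq1 r)

theorem ct_ne_zero (hq0 : 0 < q) (hq1 : q < 1) : ct l q r σ ≠ 0 := by
  have h2 : q ^ 2 - 1 ≠ 0 := by nlinarith
  exact mul_ne_zero (pow_ne_zero _ (div_ne_zero (mul_ne_zero (Real.rpow_pos_of_pos hq0 _).ne'
    (zpow_ne_zero _ hq0.ne')) h2)) (qPoch_ne_zero hq0 hq1 r)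

theorem prod_J (hq0 : 0 < q) (hq1 : q < 1) (hln : 2 * l ≤ n) {I : Finset (Fin n)}
    (hI : I ∈ idx n l r) :
    (∏ i ∈ I, J n l q σ i i.rev) * ∏ j ∈ Finset.range r, ∑ k ∈ Finset.range (j + 1), (q ^ 2) ^ k
      = c q r σ := by
  obtain ⟨h1, h2, -⟩ := mem_idx_iff.mp hI
  rw [c, qPoch_eq hq0 hq1, Finset.prod_congr rfl fun i hi => J_rev hln (h1 i hi), Finset.prod_const,
    h2]

/-- In `1`-based indices `n - i' = i - 1`, which is the `0`-based index itself. -/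
theorem twoRho_image_rev (I : Finset (Fin n)) :
    twoRho (I.image Fin.rev) = ∑ i ∈ I, 2 * ((i : ℕ) : ℤ) := by
  rw [twoRho, Finset.sum_image fun _ _ _ _ h => Fin.rev_injective h]
  refine Finset.sum_congr rfl fun i _ => ?_
  have := i.isLt
  rw [Fin.val_rev]
  omega

theorem prod_Jt (hq0 : 0 < q) (hq1 : q < 1) (hln : 2 * l ≤ n) {I : Finset (Fin n)}
    (hI : I ∈ idx n l r) :
    (∏ i ∈ I, Jt n l q σ i i.rev) * ∏ j ∈ Finset.range r, ∑ k ∈ Finset.range (j + 1), (q ^ 2) ^ k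
      = ct l q r σ * q ^ twoRho (I.image Fin.rev) := by
  obtain ⟨h1, h2, -⟩ := mem_idx_iff.mp hI
  -- The exponent `2 (k - l)` is split as `2 (1 - l) + 2 (k - 1)`: the first part goes into the
  -- constant, the second builds up `⟨2ρ, ε_{I'}⟩`.
  have h3 : ∀ i ∈ I, Jt n l q σ i i.rev
      = -(q ^ (σ - 1) * q ^ (2 * (1 - (l : ℤ)))) * q ^ (2 * ((i : ℕ) : ℤ)) := by
    intro i hi
    rw [Jt_rev hln (h1 i hi), neg_mul, mul_assoc, ← zpow_add₀ hq0.ne']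
    congr 4
    ring
  have h4 : ∏ i ∈ I, q ^ (2 * ((i : ℕ) : ℤ)) = q ^ ∑ i ∈ I, 2 * ((i : ℕ) : ℤ) := by
    clear hI h1 h2 h3
    induction I using Finset.induction_on with
    | empty => simp
    | insert i I hi ih => rw [Finset.prod_insert hi, Finset.sum_insert hi, ih, zpow_add₀ hq0.ne']
  rw [ct, qPoch_eq hq0 hq1, Finset.prod_congr rfl h3, Finset.prod_mul_distrib, Finset.prod_const,
    h2, twoRho_image_rev, h4]
  ring

end Constants

end QGrass

theorem mainTheorem6 (n l r : ℕ) (q : ℝ) (hn : 2 ≤ n) (hl : 1 ≤ l) (hln : 2 * l ≤ n)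
    (hr : 1 ≤ r) (hrl : r ≤ l) (hq0 : 0 < q) (hq1 : q < 1) :
    Function.Surjective (QGrass.PsiHat n q r) ∧
    ∃ (ρ : QGrass.L n q →ₐ[ℂ] QGrass.L n q ⊗[ℂ] QGrass.Aq n q)
      (ρd : QGrass.Ld n q →ₐ[ℂ] QGrass.Ld n q ⊗[ℂ] QGrass.Aq n q),
      QGrass.IsCoactionL ρ ∧ QGrass.IsCoactionLd ρd ∧
      QGrass.IsIntertwiner (QGrass.coactSrc n q r)
        (QGrass.tensorCoaction ρ.toLinearMap ρd.toLinearMap)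
        (QGrass.incl n q r ∘ₗ QGrass.PsiHat n q r) ∧
      ∀ σ : ℝ,
        QGrass.principalTerm (QGrass.tensorCoaction ρ.toLinearMap ρd.toLinearMap) l r
            (QGrass.incl n q r (QGrass.PsiHat n q r (QGrass.pow r (QGrass.w n l q σ))))
          = (QGrass.c q r σ : ℂ) • QGrass.u n l q r ∧
        QGrass.principalTerm (QGrass.tensorCoaction ρ.toLinearMap ρd.toLinearMap) l r
            (QGrass.incl n q r (QGrass.PsiHat n q r (QGrass.pow r (QGrass.wt n l q σ))))
          = (QGrass.ct l q r σ : ℂ) • QGrass.ut n l q r ∧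
        QGrass.c q r σ ≠ 0 ∧ QGrass.ct l q r σ ≠ 0 := by
  have hq : q ≠ 0 := hq0.ne'
  obtain ⟨ρ, hρ⟩ := QGrass.exists_coactionL (n := n) hq
  obtain ⟨ρd, hρd⟩ := QGrass.exists_coactionLd (n := n) hq
  refine ⟨QGrass.PsiHat_surjective hq, ρ, ρd, hρ, hρd, QGrass.PsiHat_intertwiner hq hρ hρd,
    fun σ => ⟨?_, ?_, QGrass.c_ne_zero hq0 hq1, QGrass.ct_ne_zero hq0 hq1⟩⟩
  · rw [QGrass.w, QGrass.principalTerm_PsiHat hq hrl hln hρ hρd _ fun _ _ => QGrass.J_ne_zero,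
      QGrass.u, Finset.smul_sum]
    refine Finset.sum_congr rfl fun I hI => ?_
    rw [← QGrass.prod_J hq0 hq1 hln hI]
    push_cast
    rfl
  · rw [QGrass.wt, QGrass.principalTerm_PsiHat hq hrl hln hρ hρd _ fun _ _ => QGrass.Jt_ne_zero,
      QGrass.ut, Finset.smul_sum]
    refine Finset.sum_congr rfl fun I hI => ?_
    have h := congrArg (fun x : ℝ => (x : ℂ)) (QGrass.prod_Jt (σ := σ) hq0 hq1 hln hI)
    push_cast at h
    rw [h, mul_smul]
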